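/- **Conventions.** All Hilbert spaces are complex. $\mathbb{T}$ carries normalized Lebesgue measure. For Hilbert spaces $\mathcal{F},\mathcal{E}$, $L^\infty_{\mathcal{B}(\mathcal{F},\mathcal{E})}(\mathbb{T})$ consists of the essentially bounded functions $\Phi:\mathbb{T}\to\mathcal{B}(\mathcal{F},\mathcal{E})$ such that $\Phi(\cdot)v$ and $\Phi(\cdot)^*w$ are (strongly) measurable for all $v\in\mathcal{F}$, $w\in\mathcal{E}$ (for separable spaces this is weak measurability of $\Phi$). $H^2_{\mathcal{E}}$ is the closed subspace of $L^2_{\mathcal{E}}(\mathbb{T})$ of functions with vanishing negative Fourier coefficients, $M_z$ is multiplication by $e^{it}$ on it, and for $\Phi\in L^\infty_{\mathcal{B}(\mathcal{E})}(\mathbb{T})=L^\infty_{\mathcal{B}(\mathcal{E},\mathcal{E})}(\mathbb{T})$ the Toeplitz operator is $T_\Phi f=P_{H^2_{\mathcal{E}}}(\Phi f)$, $f\in H^2_{\mathcal{E}}$. $H^\infty_{\mathcal{B}(\mathcal{F},\mathcal{E})}(\mathbb{D})$ is the set of bounded analytic functions $\Theta:\mathbb{D}\to\mathcal{B}(\mathcal{F},\mathcal{E})$;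 $\Theta(e^{it})$ denotes the strong radial limit $\lim_{r\uparrow1}\Theta(re^{it})$, and $\Theta$ is inner if for almost every $t$ this limit exists in the strong operator topology and is an isometry $\mathcal{F}\to\mathcal{E}$. **Proposition.** Let $\mathcal{E}$ be a Hilbert space and $\Phi\in L^\infty_{\mathcal{B}(\mathcal{E})}(\mathbb{T})$. The following are equivalent: (i) there exist a Hilbert space $\mathcal{F}\neq\{0\}$, an inner function $\Theta\in H^\infty_{\mathcal{B}(\mathcal{F},\mathcal{E})}(\mathbb{D})$ and a unitary $U:\mathcal{F}\to\mathcal{F}$ such that $$\Phi(e^{it})\Theta(e^{it})=\Theta(e^{it})U\quad\text{and}\quad \Phi(e^{it})^*\Theta(e^{it})=\Theta(e^{it})U^*\qquad\text{for a.e. } e^{it}\in\mathbb{T};$$ (ii) there exists a nonzero closed $M_z$-invariant subspace $\mathcal{S}\subseteq H^2_{\mathcal{E}}$ which reduces $T_\Phi$ (that is, $T_\Phi\mathcal{S}\subseteq\mathcal{S}$ and $T_\Phi^*\mathcal{S}\subseteq\mathcal{S}$) and on which $T_\Phi|_{\mathcal{S}}$ is unitary. Moreover, for every $\mathcal{S}$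 as in (ii), $T_\Phi|_{\mathcal{S}}$ is unitarily equivalent to a constant unitary: there are a Hilbert space $\mathcal{F}$, a unitary $U$ on $\mathcal{F}$, and a unitary $W:\mathcal{S}\to H^2_{\mathcal{F}}$ with $W\,T_\Phi|_{\mathcal{S}}=T_U\,W$, where $T_U$ is the Toeplitz operator on $H^2_{\mathcal{F}}$ with constant symbol $U$. -/

import Mathlib

open MeasureTheory Filter Topology
open scoped ENNReal

noncomputable section

namespace HardyToeplitz

instance factTwoPiPos : Fact ((0 : ℝ) < 2 * Real.pi) := ⟨Real.two_pi_pos⟩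

/-- The unit circle, parametrized by the angle `t` modulo `2π`;
the point `e^{it}` is `fourier 1 t`. -/
abbrev 𝕋 : Type := AddCircle (2 * Real.pi)

/-- Normalized Lebesgue measure on the circle. -/
abbrev μ : Measure 𝕋 := AddCircle.haarAddCircle

section Basic

variable {E : Type*} [NormedAddCommGroup E] [InnerProductSpace ℂ E]
variable {F : Type*} [NormedAddCommGroup F] [InnerProductSpace ℂ F]

/-- `L²_E(𝕋)`. -/
abbrev L2 (E : Type*) [NormedAddCommGroup E] : Type _ := Lp E 2 μ

/-- Membership in `L^∞_{B(F,E)}(𝕋)`: the operator-valued function `Φ` is essentially bounded, and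
`Φ(·)v` and `Φ(·)*w` are (strongly) measurable for all vectors `v`, `w`. For separable spaces the
measurability requirement is the usual weak measurability of `Φ`, by Pettis' theorem.
Measurability for the operator norm is not required. -/
structure MemLinfty [CompleteSpace E] [CompleteSpace F] (Φ : 𝕋 → F →L[ℂ] E) : Prop where
  meas : ∀ v : F, AEStronglyMeasurable (fun t => Φ t v) μ
  meas_adjoint : ∀ w : E, AEStronglyMeasurable (fun t => (Φ t).adjoint w) μ
  bdd : ∃ C : ℝ, ∀ᵐ t ∂μ, ‖Φ t‖ ≤ C

theorem aestronglyMeasurable_apply {Φ : 𝕋 → F →L[ℂ] E}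
    (hΦ : ∀ v : F, AEStronglyMeasurable (fun t => Φ t v) μ) {f : 𝕋 → F}
    (hf : AEStronglyMeasurable f μ) : AEStronglyMeasurable (fun t => Φ t (f t)) μ := by
  obtain ⟨g, hg, hfg⟩ := hf
  have hs : ∀ s : SimpleFunc 𝕋 F, AEStronglyMeasurable (fun t => Φ t (s t)) μ := by
    intro s
    induction s using SimpleFunc.induction with
    | @const c A hA =>
      have h : (fun t => Φ t ((SimpleFunc.piecewise A hA (SimpleFunc.const 𝕋 c)
          (SimpleFunc.const 𝕋 0)) t)) = A.indicator (fun t => Φ t c) := by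
        funext t
        by_cases ht : t ∈ A <;> simp [ht]
      rw [h]
      exact (hΦ c).indicator hA
    | add _ h1 h2 =>
      simpa [Pi.add_def] using h1.add h2
  have hgm : AEStronglyMeasurable (fun t => Φ t (g t)) μ := by
    refine aestronglyMeasurable_of_tendsto_ae atTop (fun n => hs (hg.approx n)) ?_
    exact Eventually.of_forall fun t => ((Φ t).continuous.tendsto _).comp (hg.tendsto_approx t)
  refine hgm.congr ?_
  filter_upwards [hfg] with t ht
  rw [ht]

variable [CompleteSpace E] [CompleteSpace F]

theorem MemLinfty.memLp_apply {Φ : 𝕋 → F →L[ℂ] E} (hΦ : MemLinfty Φ) (f : L2 F) :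
    MemLp (fun t => Φ t (f t)) 2 μ := by
  obtain ⟨C, hC⟩ := hΦ.bdd
  refine MemLp.of_le_mul (c := C) (Lp.memLp f)
    (aestronglyMeasurable_apply hΦ.meas (Lp.aestronglyMeasurable f)) ?_
  filter_upwards [hC] with t ht
  exact ((Φ t).le_opNorm _).trans (by gcongr)

/-- The Laurent (multiplication) operator `(L_Φ f)(t) = Φ(t) f(t)` from `L²_F(𝕋)` to `L²_E(𝕋)`. -/
def laurent {Φ : 𝕋 → F →L[ℂ] E} (hΦ : MemLinfty Φ) : L2 F →L[ℂ] L2 E :=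
  LinearMap.mkContinuousOfExistsBound
    { toFun := fun f => (hΦ.memLp_apply f).toLp _
      map_add' := by
        intro f g
        rw [← MemLp.toLp_add]
        refine MemLp.toLp_congr _ _ ?_
        filter_upwards [Lp.coeFn_add f g] with t ht
        rw [ht, Pi.add_apply, map_add, Pi.add_apply]
      map_smul' := by
        intro c f
        rw [RingHom.id_apply, ← MemLp.toLp_const_smul]
        refine MemLp.toLp_congr _ _ ?_
        filter_upwards [Lp.coeFn_smul c f] with t ht
        rw [ht, Pi.smul_apply, map_smul, Pi.smul_apply] }
    (by
      obtain ⟨C, hC⟩ := hΦ.bdd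
      refine ⟨C, fun f => Lp.norm_le_mul_norm_of_ae_le_mul ?_⟩
      filter_upwards [hC, (hΦ.memLp_apply f).coeFn_toLp] with t ht ht'
      refine (le_of_eq (congrArg norm ht')).trans ?_
      exact ((Φ t).le_opNorm _).trans (by gcongr))

theorem coeFn_laurent {Φ : 𝕋 → F →L[ℂ] E} (hΦ : MemLinfty Φ) (f : L2 F) :
    laurent hΦ f =ᵐ[μ] fun t => Φ t (f t) :=
  (hΦ.memLp_apply f).coeFn_toLp

theorem integrable_L2 {E : Type*} [NormedAddCommGroup E] (f : L2 E) : Integrable f μ :=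
  (Lp.memLp f).integrable one_le_two

theorem norm_fourierCoeff_le (f : L2 E) (n : ℤ) : ‖fourierCoeff f n‖ ≤ ‖f‖ := by
  have h1 : ‖fourierCoeff f n‖ ≤ ∫ t, ‖f t‖ ∂μ := by
    refine (norm_integral_le_integral_norm _).trans (le_of_eq ?_)
    refine integral_congr_ae (Eventually.of_forall fun t => ?_)
    show ‖(fourier (-n) t : ℂ) • f t‖ = ‖f t‖
    rw [norm_smul, fourier_apply, Circle.norm_coe, one_mul]
  refine h1.trans ?_
  have h2 : eLpNorm f 1 μ ≤ eLpNorm f 2 μ :=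
    eLpNorm_le_eLpNorm_of_exponent_le one_le_two (Lp.aestronglyMeasurable f)
  rw [integral_norm_eq_lintegral_enorm (Lp.aestronglyMeasurable f), ← eLpNorm_one_eq_lintegral_enorm,
    Lp.norm_def]
  exact ENNReal.toReal_mono (Lp.eLpNorm_ne_top f) h2

/-- The `n`-th Fourier coefficient as a bounded operator on `L²_E(𝕋)`. -/
def coeffL (E : Type*) [NormedAddCommGroup E] [InnerProductSpace ℂ E] [CompleteSpace E] (n : ℤ) :
    L2 E →L[ℂ] E :=
  LinearMap.mkContinuous
    { toFun := fun f => fourierCoeff f n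
      map_add' := by
        intro f g
        rw [fourierCoeff_congr_ae (Lp.coeFn_add f g),
          fourierCoeff.add (integrable_L2 f) (integrable_L2 g), Pi.add_apply]
      map_smul' := by
        intro c f
        rw [fourierCoeff_congr_ae (Lp.coeFn_smul c f), fourierCoeff.const_smul, RingHom.id_apply] }
    1 (fun f => by rw [one_mul]; exact norm_fourierCoeff_le f n)

/-- The Hardy space `H²_E`, realized through boundary values as the subspace of `L²_E(𝕋)` of the
functions `∑_{n ≥ 0} a_n e^{int}`, i.e. those whose negative Fourier coefficients vanish. -/
def H2 (E : Type*) [NormedAddCommGroup E] [InnerProductSpace ℂ E] [CompleteSpace E] :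
    Submodule ℂ (L2 E) where
  carrier := {f | ∀ n : ℤ, n < 0 → fourierCoeff f n = 0}
  zero_mem' := fun n _ => (coeffL E n).map_zero
  add_mem' := fun {f g} hf hg n hn => by
    have h := (coeffL E n).map_add f g
    exact h.trans (by rw [show coeffL E n f = 0 from hf n hn, show coeffL E n g = 0 from hg n hn,
      add_zero])
  smul_mem' := fun c f hf n hn => by
    have h := (coeffL E n).map_smul c f
    exact h.trans (by rw [show coeffL E n f = 0 from hf n hn, smul_zero])

theorem mem_H2 {f : L2 E} : f ∈ H2 E ↔ ∀ n : ℤ, n < 0 → fourierCoeff f n = 0 := Iff.rfl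

theorem isClosed_H2 : IsClosed (H2 E : Set (L2 E)) := by
  have h : (H2 E : Set (L2 E)) = ⋂ n : ℤ, ⋂ _ : n < 0, {f | coeffL E n f = 0} := by
    ext f
    simp only [Set.mem_iInter, Set.mem_ofPred_eq]
    exact Iff.rfl
  rw [h]
  exact isClosed_iInter fun n => isClosed_iInter fun _ =>
    isClosed_eq (coeffL E n).continuous continuous_const

instance completeSpace_H2 : CompleteSpace (H2 E) := isClosed_H2.completeSpace_coe

/-- The Toeplitz operator `T_Φ = P_{H²} L_Φ|_{H²}`. -/
def toeplitz {Φ : 𝕋 → F →L[ℂ] E} (hΦ : MemLinfty Φ) : H2 F →L[ℂ] H2 E :=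
  (H2 E).orthogonalProjectionOnto ∘L laurent hΦ ∘L (H2 F).subtypeL

theorem memLinfty_const (A : F →L[ℂ] E) : MemLinfty (fun _ : 𝕋 => A) where
  meas _ := aestronglyMeasurable_const
  meas_adjoint _ := aestronglyMeasurable_const
  bdd := ⟨‖A‖, Eventually.of_forall fun _ => le_rfl⟩

/-- The operator-valued function `e^{it} ↦ e^{it} I_E`. -/
def zSymbol (E : Type*) [NormedAddCommGroup E] [InnerProductSpace ℂ E] :
    𝕋 → E →L[ℂ] E := fun t => (fourier 1 t : ℂ) • ContinuousLinearMap.id ℂ E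

theorem memLinfty_zSymbol : MemLinfty (zSymbol E) where
  meas v := by
    have h : Continuous fun t : 𝕋 => (fourier 1 t : ℂ) • v :=
      (fourier 1).continuous.smul continuous_const
    exact h.aestronglyMeasurable
  meas_adjoint w := by
    have h : Continuous fun t : 𝕋 => (starRingEnd ℂ (fourier 1 t : ℂ)) • w :=
      (Complex.continuous_conj.comp (fourier 1).continuous).smul continuous_const
    have h2 : (fun t : 𝕋 => (zSymbol E t).adjoint w)
        = fun t : 𝕋 => (starRingEnd ℂ (fourier 1 t : ℂ)) • w := by
      funext t
      refine ext_inner_right ℂ fun x => ?_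
      rw [ContinuousLinearMap.adjoint_inner_left, inner_smul_left]
      simp [zSymbol, inner_smul_right]
    rw [h2]
    exact h.aestronglyMeasurable
  bdd := ⟨1, Eventually.of_forall fun t => by
    refine ContinuousLinearMap.opNorm_le_bound _ zero_le_one fun v => ?_
    show ‖(fourier 1 t : ℂ) • v‖ ≤ 1 * ‖v‖
    rw [norm_smul, fourier_apply, Circle.norm_coe]⟩

theorem laurent_zSymbol_mem (f : H2 E) : laurent (memLinfty_zSymbol (E := E)) (f : L2 E) ∈ H2 E := by
  intro n hn
  rw [fourierCoeff_congr_ae (coeFn_laurent _ _)]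
  have h : fourierCoeff (fun t => zSymbol E t ((f : L2 E) t)) n
      = fourierCoeff ((f : L2 E) : 𝕋 → E) (n - 1) := by
    unfold fourierCoeff
    refine integral_congr_ae (Eventually.of_forall fun t => ?_)
    show (fourier (-n) t : ℂ) • ((fourier 1 t : ℂ) • (f : L2 E) t)
      = (fourier (-(n - 1)) t : ℂ) • (f : L2 E) t
    rw [smul_smul]
    rw [← fourier_add, show -n + 1 = -(n - 1) by ring]
  rw [h]
  exact f.2 _ (by omega)

/-- The shift `M_z` on `H²_E`, multiplication by `e^{it}`. -/
def shift (E : Type*) [NormedAddCommGroup E] [InnerProductSpace ℂ E] [CompleteSpace E] :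
    H2 E →L[ℂ] H2 E :=
  (laurent (memLinfty_zSymbol (E := E)) ∘L (H2 E).subtypeL).codRestrict (H2 E) laurent_zSymbol_mem

/-- `Θ ∈ H^∞_{B(F,E)}(𝔻)`: a bounded analytic operator-valued function on the open unit disc. -/
structure IsHInfty (Θ : ℂ → F →L[ℂ] E) : Prop where
  analytic : DifferentiableOn ℂ Θ (Metric.ball 0 1)
  bdd : ∃ C : ℝ, ∀ z ∈ Metric.ball (0 : ℂ) 1, ‖Θ z‖ ≤ C

/-- `Θb` is a boundary function of `Θ`: for almost every `t`, the operators `Θ(r e^{it})` converge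
to `Θb(t)` in the strong operator topology as `r ↑ 1`. -/
def IsBoundaryFunction (Θ : ℂ → F →L[ℂ] E) (Θb : 𝕋 → F →L[ℂ] E) : Prop :=
  ∀ᵐ t ∂μ, ∀ v : F,
    Tendsto (fun r : ℝ => Θ ((r : ℂ) * (fourier 1 t : ℂ)) v) (𝓝[<] 1) (𝓝 (Θb t v))

/-- `Θ` is an inner function in `H^∞_{B(F,E)}(𝔻)` with boundary function `Θb`:
almost every `Θb(t)` is an isometry from `F` to `E`. -/
structure IsInner (Θ : ℂ → F →L[ℂ] E) (Θb : 𝕋 → F →L[ℂ] E) : Prop where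
  hInfty : IsHInfty Θ
  boundary : IsBoundaryFunction Θ Θb
  isometry : ∀ᵐ t ∂μ, Isometry (Θb t)

end Basic

section Abstract

variable {H : Type*} [NormedAddCommGroup H] [InnerProductSpace ℂ H] [CompleteSpace H]

/-- The subspace `S` reduces the bounded operator `T`: it is invariant under `T` and `T*`. -/
structure Reduces (S : Submodule ℂ H) (T : H →L[ℂ] H) : Prop where
  map_mem : ∀ f ∈ S, T f ∈ S
  adjoint_map_mem : ∀ f ∈ S, T.adjoint f ∈ S

/-- `S` is `T`-invariant and the restriction `T|_S` is a unitary operator on `S`. -/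
def IsUnitaryOn (S : Submodule ℂ H) (T : H →L[ℂ] H) : Prop :=
  ∃ V : S ≃ₗᵢ[ℂ] S, ∀ f : S, ((V f : S) : H) = T f

end Abstract

/-- `S` is a nonzero closed subspace of `H²_E` which is invariant under `M_z`, reduces `T`, and on
which `T` restricts to a unitary operator. -/
structure IsShiftInvariantUnitaryPart {E : Type*} [NormedAddCommGroup E] [InnerProductSpace ℂ E]
    [CompleteSpace E] (T : H2 E →L[ℂ] H2 E) (S : Submodule ℂ (H2 E)) : Prop where
  closed : IsClosed (S : Set (H2 E))
  ne_bot : S ≠ ⊥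
  shift_mem : ∀ f ∈ S, shift E f ∈ S
  reduces : Reduces S T
  unitary : IsUnitaryOn S T

end HardyToeplitz

end

open HardyToeplitz

universe u

set_option linter.unusedSectionVars false

namespace HardyToeplitz

/-! (i) ⇒ (ii). Multiplication by `Θ` is an isometry `H²_F → H²_E` commuting with the shifts. The
pointwise relations make it intertwine the constant Toeplitz operators of `U` and `U*` with `T_Φ`
and `T_Φ*`, so `S = Θ H²_F` works (`IsInner.isShiftInvariantUnitaryPart`).

(ii) ⇒ (i). Every Toeplitz operator satisfies `M_z* T_Φ M_z = T_Φ`. For the unitary `V = T_Φ|_S` and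
the isometry `M = M_z|_S` this makes `‖VMf - MVf‖²` vanish, so `V` and `M` commute
(`commute_of_inner_eq`). Since `M` is pure, Wold's theorem gives `S = ⊕ Mⁿ L` with `L` the wandering
subspace. `V` restricts to a unitary `U` of `L`, and sending `Mⁿ v` to `zⁿ v` carries `V` to `T_U`
on `H²_L`: this is the final claim (`exists_wandering_model`).

To obtain an inner function, note that `v ∈ L` is orthogonal to all `zⁿ v`, `n ≥ 1`. Hence `‖v(t)‖²`
has only a zeroth Fourier coefficient, and `‖v(t)‖ = ‖v‖` a.e. Thus `Θ(z)v = v(z)`, the Poisson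
integral of `v`, is contractive, and Fatou's theorem gives its radial limits. Their exceptional null
sets depend on `v`, so `L` is replaced by a separable subspace invariant under `U` and `U⁻¹`
(`exists_isInner`). Finally `T_Φ zⁿ v = zⁿ U v` for every `n` forces `Φ v = U v` without the
projection (`laurent_eq_of_toeplitz_shift_pow`); the same holds for `Φ*`. -/

/-- A shortcut instance, preferred to the inner product coming from the `CStarModule` structure. -/
noncomputable instance innerSubmodule {H : Type*} [NormedAddCommGroup H] [InnerProductSpace ℂ H]
    (S : Submodule ℂ H) : Inner ℂ S :=
  InnerProductSpace.toInner

/-! ### Vector-valued Fourier coefficients and monomials. -/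

section Fourier

variable {E : Type*} [NormedAddCommGroup E] [InnerProductSpace ℂ E]

theorem norm_fourier_apply (n : ℤ) (t : 𝕋) : ‖(fourier n t : ℂ)‖ = 1 := Circle.norm_coe _

theorem memLp_fourier_smul (n : ℤ) (v : E) : MemLp (fun t : 𝕋 => (fourier n t : ℂ) • v) 2 μ := by
  refine MemLp.of_bound ?_ ‖v‖ (Eventually.of_forall fun t => ?_)
  · exact ((fourier n).continuous.smul continuous_const).aestronglyMeasurable
  · rw [norm_smul, norm_fourier_apply, one_mul]

theorem fourierCoeff_fourier_smul (n m : ℤ) (v : E) [CompleteSpace E] :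
    fourierCoeff (fun t : 𝕋 => (fourier n t : ℂ) • v) m = if m = n then v else 0 := by
  have h := congrFun (fourierCoeff_fourier (T := 2 * Real.pi) n) m
  have h2 : fourierCoeff (fun t : 𝕋 => (fourier n t : ℂ) • v) m =
      (fourierCoeff (fun t : 𝕋 => (fourier n t : ℂ)) m) • v := by
    unfold fourierCoeff
    rw [← integral_smul_const]
    simp only [smul_smul, smul_eq_mul]
  rw [h2]
  erw [h]
  by_cases hmn : m = n
  · subst hmn; simp
  · simp [hmn]

variable [CompleteSpace E]

theorem inner_toLp_fourier_smul (n : ℤ) (v : E) (f : L2 E) :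
    inner ℂ ((memLp_fourier_smul n v).toLp _) f = inner ℂ v (fourierCoeff f n) := by
  rw [L2.inner_def]
  have hint : Integrable (fun t => (fourier (-n) t : ℂ) • f t) μ :=
    (integrable_L2 f).fourier_smul (-n)
  unfold fourierCoeff
  rw [← integral_inner hint v]
  refine integral_congr_ae ?_
  filter_upwards [(memLp_fourier_smul n v).coeFn_toLp] with t ht
  rw [ht, inner_smul_left, inner_smul_right, fourier_neg]

/-- The isometric embedding `v ↦ e^{int} v` of the coefficient space into `L²`. -/
noncomputable def monomial (E : Type*) [NormedAddCommGroup E] [InnerProductSpace ℂ E]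
    [CompleteSpace E] (n : ℤ) : E →ₗᵢ[ℂ] L2 E where
  toFun v := (memLp_fourier_smul n v).toLp _
  map_add' v w := by
    rw [← MemLp.toLp_add]
    refine MemLp.toLp_congr _ _ (Eventually.of_forall fun t => ?_)
    simp only [Pi.add_apply, smul_add]
  map_smul' c v := by
    rw [RingHom.id_apply, ← MemLp.toLp_const_smul]
    refine MemLp.toLp_congr _ _ (Eventually.of_forall fun t => ?_)
    simp only [Pi.smul_apply]
    exact smul_comm _ _ _
  norm_map' v := by
    have h := inner_toLp_fourier_smul n v ((memLp_fourier_smul n v).toLp _)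
    rw [fourierCoeff_congr_ae (memLp_fourier_smul n v).coeFn_toLp, fourierCoeff_fourier_smul,
      if_pos rfl, inner_self_eq_norm_sq_to_K, inner_self_eq_norm_sq_to_K] at h
    have h' : ‖(memLp_fourier_smul n v).toLp _‖ ^ 2 = ‖v‖ ^ 2 := by exact_mod_cast h
    exact (pow_left_inj₀ (norm_nonneg _) (norm_nonneg _) two_ne_zero).1 h'

theorem coeFn_monomial (n : ℤ) (v : E) :
    monomial E n v =ᵐ[μ] fun t => (fourier n t : ℂ) • v :=
  (memLp_fourier_smul n v).coeFn_toLp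

theorem inner_monomial_left (n : ℤ) (v : E) (f : L2 E) :
    inner ℂ (monomial E n v) f = inner ℂ v (fourierCoeff f n) :=
  inner_toLp_fourier_smul n v f

theorem fourierCoeff_monomial (n m : ℤ) (v : E) :
    fourierCoeff (monomial E n v) m = if m = n then v else 0 := by
  rw [fourierCoeff_congr_ae (coeFn_monomial n v), fourierCoeff_fourier_smul]

theorem eq_zero_of_forall_fourierCoeff_complex {g : L2 ℂ} (h : ∀ n, fourierCoeff g n = 0) :
    g = 0 := by
  have := hasSum_fourier_series_L2 g
  simp only [h, zero_smul] at this
  exact this.unique hasSum_zero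

/-- A strongly measurable function has essentially separable range, so testing against functionals
reduces the claim to the scalar case even for nonseparable `E`. -/
theorem eq_zero_of_forall_fourierCoeff {f : L2 E} (h : ∀ n, fourierCoeff f n = 0) : f = 0 := by
  rw [Lp.eq_zero_iff_ae_eq_zero]
  obtain ⟨s, hs, hfs⟩ := (Lp.aestronglyMeasurable f).isSeparable_ae_range
  refine ae_eq_zero_of_forall_dual_of_isSeparable ℂ hs (fun c => ?_) hfs
  have hm : MemLp (fun t => c (f t)) 2 μ := (Lp.memLp f).continuousLinearMap_comp c
  have h0 : hm.toLp _ = 0 := by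
    refine eq_zero_of_forall_fourierCoeff_complex fun n => ?_
    rw [fourierCoeff_congr_ae hm.coeFn_toLp]
    unfold fourierCoeff
    have hint : Integrable (fun t => (fourier (-n) t : ℂ) • f t) μ :=
      (integrable_L2 f).fourier_smul (-n)
    have := c.integral_comp_comm hint
    simp only [map_smul] at this
    rw [this]
    have h2 := h n
    unfold fourierCoeff at h2
    rw [h2, map_zero]
  filter_upwards [hm.coeFn_toLp, (Lp.eq_zero_iff_ae_eq_zero).1 h0] with t ht ht'
  rw [← ht, ht']

theorem monomial_mem_H2 (n : ℕ) (v : E) : monomial E n v ∈ H2 E := by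
  intro m hm
  rw [fourierCoeff_monomial, if_neg]
  omega

/-- The isometric embedding `v ↦ zⁿ v` of the coefficient space into `H²`. -/
noncomputable def hardyMonomial (E : Type*) [NormedAddCommGroup E] [InnerProductSpace ℂ E]
    [CompleteSpace E] (n : ℕ) : E →ₗᵢ[ℂ] H2 E where
  toLinearMap := (monomial E n).toLinearMap.codRestrict (H2 E) (monomial_mem_H2 n)
  norm_map' v := (monomial E n).norm_map v

theorem coe_hardyMonomial (n : ℕ) (v : E) :
    (hardyMonomial E n v : L2 E) = monomial E n v := rfl

theorem inner_hardyMonomial_left (n : ℕ) (v : E) (f : H2 E) :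
    inner ℂ (hardyMonomial E n v) f = inner ℂ v (fourierCoeff (f : L2 E) n) :=
  inner_monomial_left n v f

theorem H2_ext_zero {f : H2 E} (h : ∀ n : ℕ, fourierCoeff (f : L2 E) n = 0) : f = 0 := by
  apply Subtype.ext
  refine eq_zero_of_forall_fourierCoeff fun n => ?_
  rcases lt_or_ge n 0 with hn | hn
  · exact f.2 n hn
  · lift n to ℕ using hn
    exact h n

end Fourier

/-! ### Hilbert sums of copies of one space. -/

section HilbertSum

variable {F H : Type*} [NormedAddCommGroup F] [InnerProductSpace ℂ F] [CompleteSpace F]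
  [NormedAddCommGroup H] [InnerProductSpace ℂ H] [CompleteSpace H]

theorem isHilbertSum_of_forall_inner {ι : Type*} {A : ι → F →ₗᵢ[ℂ] H}
    (horth : ∀ m n, m ≠ n → ∀ v w, inner ℂ (A m v) (A n w) = 0)
    (htot : ∀ f : H, (∀ n v, inner ℂ (A n v) f = 0) → f = 0) :
    IsHilbertSum ℂ (fun _ : ι => F) A := by
  refine IsHilbertSum.mk (fun m n hmn v w => horth m n hmn v w) ?_
  rw [top_le_iff, Submodule.topologicalClosure_eq_top_iff, Submodule.eq_bot_iff]
  intro f hf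
  refine htot f fun n v => ?_
  exact (Submodule.mem_orthogonal _ _).1 hf _
    (Submodule.mem_iSup_of_mem n (LinearMap.mem_range_self (A n).toLinearMap v))

theorem IsHilbertSum.eq_of_forall_apply {ι : Type*} {A : ι → F →ₗᵢ[ℂ] H}
    (hA : IsHilbertSum ℂ (fun _ : ι => F) A) {K : Type*} [NormedAddCommGroup K] [NormedSpace ℂ K]
    {S T : H →L[ℂ] K} (h : ∀ i v, S (A i v) = T (A i v)) : S = T := by
  ext f
  have hs := hA.hasSum_linearIsometryEquiv_symm (hA.linearIsometryEquiv f)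
  rw [LinearIsometryEquiv.symm_apply_apply] at hs
  have h1 := hs.mapL S
  have h2 := hs.mapL T
  simp only [h] at h1
  exact h1.unique h2

theorem IsHilbertSum.exists_unitary {ι : Type*} {A : ι → F →ₗᵢ[ℂ] H}
    (hA : IsHilbertSum ℂ (fun _ : ι => F) A) {K : Type*} [NormedAddCommGroup K]
    [InnerProductSpace ℂ K] [CompleteSpace K] {B : ι → F →ₗᵢ[ℂ] K}
    (hB : IsHilbertSum ℂ (fun _ : ι => F) B) :
    ∃ W : H ≃ₗᵢ[ℂ] K, ∀ i v, W (A i v) = B i v := by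
  classical
  refine ⟨hA.linearIsometryEquiv.trans hB.linearIsometryEquiv.symm, fun i v => ?_⟩
  rw [← hA.linearIsometryEquiv_symm_apply_single v, LinearIsometryEquiv.trans_apply,
    LinearIsometryEquiv.apply_symm_apply, hB.linearIsometryEquiv_symm_apply_single]

theorem isHilbertSum_hardyMonomial : IsHilbertSum ℂ (fun _ : ℕ => F) (hardyMonomial F) := by
  refine isHilbertSum_of_forall_inner (fun m n hmn v w => ?_) fun f hf => ?_
  · rw [inner_hardyMonomial_left, coe_hardyMonomial, fourierCoeff_monomial,
      if_neg (by exact_mod_cast hmn), inner_zero_right]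
  · refine H2_ext_zero fun n => ?_
    refine ext_inner_left ℂ fun v => ?_
    rw [← inner_hardyMonomial_left, hf, inner_zero_right]

end HilbertSum

/-! ### Laurent, Toeplitz and shift operators. -/

section Toeplitz

variable {E : Type*} [NormedAddCommGroup E] [InnerProductSpace ℂ E] [CompleteSpace E]
variable {F : Type*} [NormedAddCommGroup F] [InnerProductSpace ℂ F] [CompleteSpace F]

theorem MemLinfty.adjoint {Φ : 𝕋 → F →L[ℂ] E} (hΦ : MemLinfty Φ) :
    MemLinfty fun t => (Φ t).adjoint where
  meas := hΦ.meas_adjoint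
  meas_adjoint v := by simpa only [ContinuousLinearMap.adjoint_adjoint] using hΦ.meas v
  bdd := by
    obtain ⟨C, hC⟩ := hΦ.bdd
    refine ⟨C, hC.mono fun t ht => ?_⟩
    rwa [LinearIsometryEquiv.norm_map]

theorem inner_laurent_left {Φ : 𝕋 → F →L[ℂ] E} (hΦ : MemLinfty Φ) (f : L2 F) (g : L2 E) :
    inner ℂ (laurent hΦ f) g = inner ℂ f (laurent hΦ.adjoint g) := by
  rw [L2.inner_def, L2.inner_def]
  refine integral_congr_ae ?_
  filter_upwards [coeFn_laurent hΦ f, coeFn_laurent hΦ.adjoint g] with t h1 h2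
  rw [h1, h2, ContinuousLinearMap.adjoint_inner_right]

theorem inner_toeplitz_left {Φ : 𝕋 → F →L[ℂ] E} (hΦ : MemLinfty Φ) (f : H2 F) (g : H2 E) :
    inner ℂ (toeplitz hΦ f) g = inner ℂ (laurent hΦ (f : L2 F)) (g : L2 E) := by
  change inner ℂ ((H2 E).orthogonalProjectionOnto (laurent hΦ (f : L2 F))) g = _
  rw [Submodule.inner_orthogonalProjectionOnto_eq_of_mem_right]

theorem adjoint_toeplitz {Φ : 𝕋 → F →L[ℂ] E} (hΦ : MemLinfty Φ) :
    (toeplitz hΦ).adjoint = toeplitz hΦ.adjoint := by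
  symm
  rw [ContinuousLinearMap.eq_adjoint_iff]
  intro g f
  rw [← inner_conj_symm g, inner_toeplitz_left, inner_toeplitz_left, inner_laurent_left,
    inner_conj_symm]
  simp only [ContinuousLinearMap.adjoint_adjoint]

theorem toeplitz_eq_of_laurent_eq {Φ : 𝕋 → F →L[ℂ] E} (hΦ : MemLinfty Φ) {f : H2 F} {g : H2 E}
    (h : laurent hΦ (f : L2 F) = g) : toeplitz hΦ f = g := by
  change (H2 E).orthogonalProjectionOnto (laurent hΦ (f : L2 F)) = _
  rw [h, Submodule.orthogonalProjectionOnto_mem_subspace_eq_self]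

theorem fourierCoeff_fourier_smul_apply (f : 𝕋 → E) (n m : ℤ) :
    fourierCoeff (fun t => (fourier n t : ℂ) • f t) m = fourierCoeff f (m - n) := by
  unfold fourierCoeff
  refine integral_congr_ae (Eventually.of_forall fun t => ?_)
  beta_reduce
  rw [smul_smul, ← fourier_add, show -m + n = -(m - n) by ring]

theorem coeFn_shift (f : H2 E) :
    (shift E f : L2 E) =ᵐ[μ] fun t => (fourier 1 t : ℂ) • (f : L2 E) t :=
  coeFn_laurent memLinfty_zSymbol (f : L2 E)

theorem coeFn_shift_pow (n : ℕ) (f : H2 E) :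
    ((shift E ^ n) f : L2 E) =ᵐ[μ] fun t => (fourier n t : ℂ) • (f : L2 E) t := by
  induction n with
  | zero => simp
  | succ n ih =>
    rw [pow_succ']
    filter_upwards [coeFn_shift ((shift E ^ n) f), ih] with t h1 h2
    rw [mul_apply_eq_comp, h1, h2, smul_smul, ← fourier_add]
    push_cast
    rw [add_comm]

theorem fourierCoeff_shift_pow (n : ℕ) (f : H2 E) (m : ℤ) :
    fourierCoeff ((shift E ^ n) f : L2 E) m = fourierCoeff (f : L2 E) (m - n) := by
  rw [fourierCoeff_congr_ae (coeFn_shift_pow n f), fourierCoeff_fourier_smul_apply]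

theorem inner_shift_shift (f g : H2 E) : inner ℂ (shift E f) (shift E g) = inner ℂ f g := by
  rw [Submodule.coe_inner, Submodule.coe_inner, L2.inner_def, L2.inner_def]
  refine integral_congr_ae ?_
  filter_upwards [coeFn_shift f, coeFn_shift g] with t h1 h2
  rw [h1, h2, inner_smul_left, inner_smul_right, ← mul_assoc, ← fourier_neg, ← fourier_add]
  simp

theorem norm_shift (f : H2 E) : ‖shift E f‖ = ‖f‖ := by
  rw [norm_eq_sqrt_re_inner (𝕜 := ℂ), inner_shift_shift]
  exact (norm_eq_sqrt_re_inner (𝕜 := ℂ) f).symm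

/-- This is `M_z* T_Φ M_z = T_Φ` in weak form: the projection disappears when pairing with an
element of `H²`, and the unimodular factors cancel pointwise. -/
theorem inner_toeplitz_shift_shift {Φ : 𝕋 → E →L[ℂ] E} (hΦ : MemLinfty Φ) (f g : H2 E) :
    inner ℂ (toeplitz hΦ (shift E f)) (shift E g) = inner ℂ (toeplitz hΦ f) g := by
  rw [inner_toeplitz_left, inner_toeplitz_left, L2.inner_def, L2.inner_def]
  refine integral_congr_ae ?_
  filter_upwards [coeFn_shift f, coeFn_shift g, coeFn_laurent hΦ (shift E f : L2 E),
    coeFn_laurent hΦ (f : L2 E)] with t h1 h2 h3 h4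
  rw [h2, h3, h1, h4, map_smul, inner_smul_left, inner_smul_right, ← mul_assoc, ← fourier_neg,
    ← fourier_add]
  simp

theorem eq_zero_of_forall_mem_range_shift_pow {f : H2 E}
    (h : ∀ n : ℕ, ∃ g, (shift E ^ n) g = f) : f = 0 := by
  refine H2_ext_zero fun n => ?_
  -- With exponent `n + 1`, the `n`-th coefficient of `f` is the coefficient of `g` at `-1`.
  obtain ⟨g, rfl⟩ := h (n + 1)
  rw [fourierCoeff_shift_pow]
  exact g.2 _ (by push_cast; omega)

theorem fourierCoeff_clm_comp (A : F →L[ℂ] E) (f : L2 F) (n : ℤ) :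
    fourierCoeff (fun t => A (f t)) n = A (fourierCoeff f n) := by
  unfold fourierCoeff
  have hint : Integrable (fun t => (fourier (-n) t : ℂ) • f t) μ :=
    (integrable_L2 f).fourier_smul (-n)
  rw [← A.integral_comp_comm hint]
  simp only [map_smul]

theorem laurent_const_mem_H2 (A : F →L[ℂ] E) (f : H2 F) :
    laurent (memLinfty_const A) (f : L2 F) ∈ H2 E := by
  intro n hn
  rw [fourierCoeff_congr_ae (coeFn_laurent _ _), fourierCoeff_clm_comp, f.2 n hn, map_zero]

theorem coe_toeplitz_const (A : F →L[ℂ] E) (f : H2 F) :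
    (toeplitz (memLinfty_const A) f : L2 E) = laurent (memLinfty_const A) (f : L2 F) :=
  congrArg Subtype.val (toeplitz_eq_of_laurent_eq (memLinfty_const A)
    (g := ⟨_, laurent_const_mem_H2 A f⟩) rfl)

theorem coeFn_toeplitz_const (A : F →L[ℂ] E) (f : H2 F) :
    (toeplitz (memLinfty_const A) f : L2 E) =ᵐ[μ] fun t => A ((f : L2 F) t) := by
  rw [coe_toeplitz_const]
  exact coeFn_laurent _ _

theorem toeplitz_const_hardyMonomial (A : F →L[ℂ] E) (n : ℕ) (v : F) :
    toeplitz (memLinfty_const A) (hardyMonomial F n v) = hardyMonomial E n (A v) := by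
  apply Subtype.ext
  apply Lp.ext
  filter_upwards [coeFn_toeplitz_const A (hardyMonomial F n v), coeFn_monomial n v,
    coeFn_monomial n (A v)] with t h1 h2 h3
  rw [h1, coe_hardyMonomial, coe_hardyMonomial, h2, h3, map_smul]

end Toeplitz

/-! ### Wold decomposition of a pure isometry and the unitaries commuting with it. -/

section Wold

/-- In `‖VMf - MVf‖²` the cross term is `⟪VMf, MVf⟫ = ⟪Vf, Vf⟫`, so the expansion reads `‖f‖² -
2‖f‖² + ‖f‖² = 0`. -/
theorem commute_of_inner_eq {H : Type*} [NormedAddCommGroup H] [InnerProductSpace ℂ H]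
    (M : H →ₗᵢ[ℂ] H) (V : H ≃ₗᵢ[ℂ] H) (h : ∀ f g, inner ℂ (V (M f)) (M g) = inner ℂ (V f) g) (f : H) :
    V (M f) = M (V f) := by
  rw [← sub_eq_zero, ← norm_eq_zero, ← sq_eq_zero_iff, norm_sub_sq (𝕜 := ℂ), h]
  simp only [LinearIsometryEquiv.norm_map, LinearIsometry.norm_map, inner_self_eq_norm_sq]
  ring

variable {H : Type*} [NormedAddCommGroup H] [InnerProductSpace ℂ H] [CompleteSpace H]

/-- The wandering subspace of an isometry. -/
noncomputable def wandering (M : H →ₗᵢ[ℂ] H) : Submodule ℂ H := (LinearMap.range M.toLinearMap)ᗮ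

theorem mem_wandering {M : H →ₗᵢ[ℂ] H} {f : H} : f ∈ wandering M ↔ ∀ g, inner ℂ (M g) f = 0 := by
  unfold wandering
  rw [Submodule.mem_orthogonal]
  exact ⟨fun h g => h _ ⟨g, rfl⟩, by rintro h _ ⟨g, rfl⟩; exact h g⟩

instance completeSpace_wandering (M : H →ₗᵢ[ℂ] H) : CompleteSpace (wandering M) :=
  inferInstanceAs (CompleteSpace (LinearMap.range M.toLinearMap)ᗮ)

theorem mem_range_of_forall_inner_wandering (M : H →ₗᵢ[ℂ] H) {f : H}
    (h : ∀ v ∈ wandering M, inner ℂ v f = 0) : ∃ g, M g = f := by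
  have hc : IsClosed (LinearMap.range M.toLinearMap : Set H) := by
    have : (LinearMap.range M.toLinearMap : Set H) = Set.range M := by ext; simp
    rw [this]
    exact M.isometry.isClosedEmbedding.isClosed_range
  have : f ∈ (LinearMap.range M.toLinearMap)ᗮᗮ := (Submodule.mem_orthogonal _ _).2 h
  rw [Submodule.orthogonal_orthogonal_eq_closure, hc.submodule_topologicalClosure_eq] at this
  obtain ⟨g, hg⟩ := this
  exact ⟨g, hg⟩

theorem inner_pow_apply_pow_apply (M : H →ₗᵢ[ℂ] H) (n : ℕ) (f g : H) :
    inner ℂ ((M ^ n) f) ((M ^ n) g) = inner ℂ f g :=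
  (M ^ n).inner_map_map f g

/-- Totality: if `f = Mⁿ g` is orthogonal to `Mⁿ` of the wandering subspace, then `g` is orthogonal
to that subspace and so lies in the closed range of `M`. Inductively `f` lies in the range of every
power, and purity gives `f = 0`. -/
theorem isHilbertSum_wandering (M : H →ₗᵢ[ℂ] H) (hM : ∀ f, (∀ n : ℕ, ∃ g, (M ^ n) g = f) → f = 0) :
    IsHilbertSum ℂ (fun _ : ℕ => wandering M)
      fun n => (M ^ n).comp (wandering M).subtypeₗᵢ := by
  have key : ∀ m n : ℕ, m < n → ∀ v ∈ wandering M, ∀ g : H,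
      inner ℂ ((M ^ n) g) ((M ^ m) v) = 0 := by
    intro m n hmn v hv g
    obtain ⟨k, rfl⟩ := Nat.exists_eq_add_of_lt hmn
    rw [add_assoc, pow_add, pow_succ']
    exact (inner_pow_apply_pow_apply M m _ v).trans (mem_wandering.1 hv _)
  refine isHilbertSum_of_forall_inner (fun m n hmn v w => ?_) fun f hf => hM f fun n => ?_
  · rcases lt_or_gt_of_ne hmn with h | h
    · rw [← inner_conj_symm]
      exact (congrArg _ (key m n h v v.2 w)).trans (map_zero _)
    · exact key n m h w w.2 v
  · induction n with
    | zero => exact ⟨f, rfl⟩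
    | succ n ih =>
      obtain ⟨g, rfl⟩ := ih
      obtain ⟨k, rfl⟩ := mem_range_of_forall_inner_wandering M (f := g) fun v hv => by
        rw [← inner_pow_apply_pow_apply M n]
        exact hf n ⟨v, hv⟩
      exact ⟨k, by rw [pow_succ]; rfl⟩

/-- Surjectivity of `V` matters: `Mg = V M V⁻¹ g`, so pairing `Vv` with `Mg` reduces to pairing `v`
with `M V⁻¹ g`. -/
theorem map_mem_wandering {M : H →ₗᵢ[ℂ] H} {V : H ≃ₗᵢ[ℂ] H} (h : ∀ f, V (M f) = M (V f)) {v : H}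
    (hv : v ∈ wandering M) : V v ∈ wandering M := by
  rw [mem_wandering] at hv ⊢
  intro g
  rw [← V.apply_symm_apply g, ← h, V.inner_map_map, hv]

/-- A unitary operator mapping a subspace into itself, as does its inverse,
restricts to a unitary operator. -/
noncomputable def restrictUnitary (V : H ≃ₗᵢ[ℂ] H) (G : Submodule ℂ H) (h : ∀ v ∈ G, V v ∈ G)
    (h' : ∀ v ∈ G, V.symm v ∈ G) : G ≃ₗᵢ[ℂ] G where
  toLinearEquiv := LinearEquiv.ofLinearMap (V.toLinearEquiv.toLinearMap.restrict h)
    (V.symm.toLinearEquiv.toLinearMap.restrict h') (by ext; simp) (by ext; simp)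
  norm_map' v := V.norm_map v

theorem map_symm_commute {M : H →ₗᵢ[ℂ] H} {V : H ≃ₗᵢ[ℂ] H} (h : ∀ f, V (M f) = M (V f)) (f : H) :
    V.symm (M f) = M (V.symm f) := by
  rw [LinearIsometryEquiv.symm_apply_eq, h, LinearIsometryEquiv.apply_symm_apply]

theorem pow_commute {M : H →ₗᵢ[ℂ] H} {V : H ≃ₗᵢ[ℂ] H} (h : ∀ f, V (M f) = M (V f)) (n : ℕ)
    (f : H) : V ((M ^ n) f) = (M ^ n) (V f) := by
  induction n generalizing f with
  | zero => rfl
  | succ n ih =>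
    rw [pow_succ]
    exact (ih (M f)).trans (congrArg _ (h f))

end Wold

/-! ### The Poisson kernel: Fourier expansion and size estimates. -/

section Poisson

variable {E : Type*} [NormedAddCommGroup E] [NormedSpace ℂ E] [CompleteSpace E]

/-- The Poisson kernel of the unit disc at the boundary point `e^{it}`. -/
noncomputable def diskPoisson (z : ℂ) (t : 𝕋) : ℝ := poissonKernel 0 z (fourier 1 t)

theorem diskPoisson_eq (z : ℂ) (t : 𝕋) :
    diskPoisson z t = (1 - ‖z‖ ^ 2) / ‖(fourier 1 t : ℂ) - z‖ ^ 2 := by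
  unfold diskPoisson poissonKernel
  rw [sub_zero, sub_zero, norm_fourier_apply, one_pow]

theorem fourier_ne {z : ℂ} (hz : ‖z‖ < 1) (t : 𝕋) : (fourier 1 t : ℂ) - z ≠ 0 := by
  intro h
  rw [sub_eq_zero] at h
  rw [← h, norm_fourier_apply] at hz
  exact lt_irrefl _ hz

theorem diskPoisson_nonneg {z : ℂ} (hz : ‖z‖ < 1) (t : 𝕋) : 0 ≤ diskPoisson z t := by
  rw [diskPoisson_eq]
  have : ‖z‖ ^ 2 ≤ 1 := pow_le_one₀ (norm_nonneg _) hz.le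
  exact div_nonneg (by linarith) (by positivity)

theorem continuous_diskPoisson {z : ℂ} (hz : ‖z‖ < 1) : Continuous (diskPoisson z) := by
  have : diskPoisson z = fun t => (1 - ‖z‖ ^ 2) / ‖(fourier 1 t : ℂ) - z‖ ^ 2 :=
    funext (diskPoisson_eq z)
  rw [this]
  refine continuous_const.div ?_ fun t => ?_
  · exact (((fourier 1).continuous.sub continuous_const).norm).pow 2
  · exact pow_ne_zero _ (norm_ne_zero_iff.2 (fourier_ne hz t))

theorem integrable_diskPoisson_smul {z : ℂ} (hz : ‖z‖ < 1) {f : 𝕋 → E} (hf : Integrable f μ) :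
    Integrable (fun t => (diskPoisson z t : ℂ) • f t) μ := by
  obtain ⟨C, hC⟩ := isCompact_univ.exists_bound_of_continuousOn
    (Complex.continuous_ofReal.comp (continuous_diskPoisson hz)).continuousOn
  exact hf.bdd_smul C (Complex.continuous_ofReal.comp
    (continuous_diskPoisson hz)).aestronglyMeasurable
    (Eventually.of_forall fun t => hC t (Set.mem_univ _))

theorem fourier_neg_one_mul (t : 𝕋) : (fourier (-1) t : ℂ) * fourier 1 t = 1 := by
  rw [← fourier_add]
  simp

theorem fourier_natCast (n : ℕ) (t : 𝕋) : (fourier n t : ℂ) = (fourier 1 t : ℂ) ^ n := by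
  induction n with
  | zero => simp
  | succ n ih => rw [pow_succ, ← ih, ← fourier_add]; push_cast; rfl

theorem fourier_neg_natCast (n : ℕ) (t : 𝕋) :
    (fourier (-(n : ℤ)) t : ℂ) = (fourier (-1) t : ℂ) ^ n := by
  rw [fourier_neg, fourier_neg, fourier_natCast, map_pow]

/-- With `w = z e^{-it}` the kernel is `1/(1 - w) + w̄/(1 - w̄)`. The frequency `-n` is paired with
`n + 1`, so that each frequency occurs once in a sum over `ℕ`. -/
theorem hasSum_diskPoisson {z : ℂ} (hz : ‖z‖ < 1) (t : 𝕋) :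
    HasSum (fun n : ℕ => z ^ n * (fourier (-(n : ℤ)) t : ℂ) +
      (starRingEnd ℂ z) ^ (n + 1) * (fourier ((n + 1 : ℕ) : ℤ) t : ℂ)) (diskPoisson z t : ℂ) := by
  set e : ℂ := fourier 1 t with he
  have hec : (fourier (-1) t : ℂ) = starRingEnd ℂ e := fourier_neg
  have hee : starRingEnd ℂ e * e = 1 := by rw [← hec]; exact fourier_neg_one_mul t
  set w : ℂ := z * starRingEnd ℂ e with hw
  have hwn : ‖w‖ < 1 := by
    rw [hw, norm_mul, RCLike.norm_conj, he, norm_fourier_apply, mul_one]; exact hz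
  have hwn' : ‖starRingEnd ℂ w‖ < 1 := by rwa [RCLike.norm_conj]
  have h1 := hasSum_geometric_of_norm_lt_one hwn
  have h2 := (hasSum_geometric_of_norm_lt_one hwn').mul_left (starRingEnd ℂ w)
  have h3 := h1.add h2
  have hw1 : (1 : ℂ) - w ≠ 0 := by
    intro h; rw [sub_eq_zero] at h; rw [← h, norm_one] at hwn; exact lt_irrefl _ hwn
  have hw2 : (1 : ℂ) - starRingEnd ℂ w ≠ 0 := by
    intro h; rw [sub_eq_zero] at h; rw [← h, norm_one] at hwn'; exact lt_irrefl _ hwn'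
  have hf : (fun n : ℕ => z ^ n * (fourier (-(n : ℤ)) t : ℂ) +
      (starRingEnd ℂ z) ^ (n + 1) * (fourier ((n + 1 : ℕ) : ℤ) t : ℂ)) =
      fun n => w ^ n + starRingEnd ℂ w * starRingEnd ℂ w ^ n := by
    funext n
    rw [fourier_neg_natCast, fourier_natCast, hec, ← he, hw, map_mul, Complex.conj_conj]
    ring
  have hn : ‖e - z‖ = ‖1 - w‖ := by
    have : e * (1 - w) = e - z := by
      rw [hw]; linear_combination (-z) * hee
    rw [← this, norm_mul, he, norm_fourier_apply, one_mul]
  have hzw : ‖z‖ = ‖w‖ := by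
    rw [hw, norm_mul, RCLike.norm_conj, he, norm_fourier_apply, mul_one]
  have hP : (diskPoisson z t : ℂ) =
      (1 - w)⁻¹ + starRingEnd ℂ w * (1 - starRingEnd ℂ w)⁻¹ := by
    rw [diskPoisson_eq, ← he, hn, hzw]
    push_cast
    rw [← Complex.mul_conj', ← Complex.mul_conj', map_sub, map_one]
    field_simp
    ring
  rw [hf, hP]
  exact h3

/-- Integrating the kernel expansion termwise, the positive frequencies of the kernel meet the
vanishing negative coefficients of `f`; only the Taylor series remains. -/
theorem hasSum_integral_diskPoisson {z : ℂ} (hz : ‖z‖ < 1) {f : 𝕋 → E} (hf : Integrable f μ)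
    (h0 : ∀ n : ℤ, n < 0 → fourierCoeff f n = 0) :
    HasSum (fun n : ℕ => z ^ n • fourierCoeff f n) (∫ t, (diskPoisson z t : ℂ) • f t ∂μ) := by
  have hi : ∀ (n : ℤ) (c : ℂ), Integrable (fun t => c • (fourier n t : ℂ) • f t) μ :=
    fun n c => (hf.fourier_smul n).smul c
  have hF : ∀ n : ℕ, Integrable (fun t => (z ^ n * (fourier (-(n : ℤ)) t : ℂ) +
      (starRingEnd ℂ z) ^ (n + 1) * (fourier ((n + 1 : ℕ) : ℤ) t : ℂ)) • f t) μ := by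
    intro n
    simp only [add_smul, mul_smul]
    exact (hi _ _).add (hi _ _)
  have hb : ∀ (n : ℕ) (t : 𝕋), ‖(z ^ n * (fourier (-(n : ℤ)) t : ℂ) +
      (starRingEnd ℂ z) ^ (n + 1) * (fourier ((n + 1 : ℕ) : ℤ) t : ℂ)) • f t‖ ≤
      (‖z‖ ^ n * 2) * ‖f t‖ := by
    intro n t
    rw [norm_smul]
    refine mul_le_mul_of_nonneg_right ?_ (norm_nonneg _)
    refine (norm_add_le _ _).trans ?_
    rw [norm_mul, norm_mul, norm_fourier_apply, norm_fourier_apply, norm_pow, norm_pow,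
      RCLike.norm_conj, pow_succ]
    nlinarith [pow_nonneg (norm_nonneg z) n]
  have hs : Summable fun n : ℕ => (‖z‖ ^ n * 2) * ∫ t, ‖f t‖ ∂μ :=
    ((summable_geometric_of_lt_one (norm_nonneg _) hz).mul_right _).mul_right _
  have h := hasSum_integral_of_summable_integral_norm hF
    (Summable.of_nonneg_of_le (fun n => integral_nonneg fun t => norm_nonneg _) (fun n => by
      rw [← integral_const_mul]
      exact integral_mono (hF n).norm (hf.norm.const_mul _) (hb n)) hs)
  have h1 : (fun n : ℕ => ∫ t, (z ^ n * (fourier (-(n : ℤ)) t : ℂ) +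
      (starRingEnd ℂ z) ^ (n + 1) * (fourier ((n + 1 : ℕ) : ℤ) t : ℂ)) • f t ∂μ) =
      fun n : ℕ => z ^ n • fourierCoeff f n := by
    funext n
    simp only [add_smul, mul_smul]
    rw [integral_add (hi _ _) (hi _ _), integral_smul, integral_smul]
    have h1 := h0 (-((n + 1 : ℕ) : ℤ)) (by push_cast; omega)
    unfold fourierCoeff at h1
    rw [neg_neg] at h1
    rw [h1, smul_zero, add_zero]
    rfl
  have h2 : (fun t => ∑' n : ℕ, (z ^ n * (fourier (-(n : ℤ)) t : ℂ) +
      (starRingEnd ℂ z) ^ (n + 1) * (fourier ((n + 1 : ℕ) : ℤ) t : ℂ)) • f t) =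
      fun t => (diskPoisson z t : ℂ) • f t :=
    funext fun t => ((hasSum_diskPoisson hz t).smul_const (f t)).tsum_eq
  rw [h1, h2] at h
  exact h

theorem integral_diskPoisson {z : ℂ} (hz : ‖z‖ < 1) : ∫ t, diskPoisson z t ∂μ = 1 := by
  have hc : ∀ n : ℤ, fourierCoeff (fun _ : 𝕋 => (1 : ℂ)) n = if n = 0 then 1 else 0 := by
    intro n
    have := fourierCoeff_fourier_smul 0 n (1 : ℂ)
    simpa using this
  have h := hasSum_integral_diskPoisson hz (f := fun _ => (1 : ℂ)) (integrable_const _)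
    fun n hn => by rw [hc, if_neg hn.ne]
  have h2 : HasSum (fun n : ℕ => z ^ n • fourierCoeff (fun _ : 𝕋 => (1 : ℂ)) n) 1 := by
    have := hasSum_ite_eq (0 : ℕ) (1 : ℂ)
    convert this using 2 with n
    rw [hc]
    rcases eq_or_ne n 0 with rfl | hn
    · simp
    · simp [hn]
  have h3 := h.unique h2
  simp only [smul_eq_mul, mul_one] at h3
  rw [integral_complex_ofReal] at h3
  exact_mod_cast h3

/-- Arc against chord: `|e^{iy} - 1| = 2|sin(y/2)|`, and Jordan's inequality applies once `y` is
shifted by the nearest multiple of `2π`. -/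
theorem norm_le_mul_norm_toCircle_sub_one (x : 𝕋) :
    ‖x‖ ≤ Real.pi / 2 * ‖(fourier 1 x : ℂ) - 1‖ := by
  induction x using QuotientAddGroup.induction_on with | H y => ?_
  change ‖(y : AddCircle (2 * Real.pi))‖ ≤
    Real.pi / 2 * ‖(fourier 1 (y : AddCircle (2 * Real.pi)) : ℂ) - 1‖
  have hpi := Real.pi_pos
  set n := round ((2 * Real.pi)⁻¹ * y) with hn
  have h1 : (fourier 1 (y : AddCircle (2 * Real.pi)) : ℂ) = Complex.exp (Complex.I * y) := by
    rw [fourier_coe_apply]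
    congr 1
    have : (Real.pi : ℂ) ≠ 0 := by exact_mod_cast hpi.ne'
    push_cast
    field_simp
  have h2 : |Real.sin (y / 2)| = |Real.sin (y / 2 - n * Real.pi)| := by
    rw [Real.sin_sub_int_mul_pi, abs_mul, abs_zpow, abs_neg, abs_one, one_zpow, one_mul]
  have h3 : |y / 2 - n * Real.pi| ≤ Real.pi / 2 := by
    have h4 := abs_sub_round ((2 * Real.pi)⁻¹ * y)
    rw [← hn] at h4
    have h5 : y / 2 - n * Real.pi = Real.pi * ((2 * Real.pi)⁻¹ * y - n) := by field_simp
    rw [h5, abs_mul, abs_of_pos hpi]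
    nlinarith
  have h6 := Real.mul_abs_le_abs_sin h3
  rw [h1, Complex.norm_exp_I_mul_ofReal_sub_one, AddCircle.norm_eq, ← hn, Real.norm_eq_abs,
    abs_mul, abs_two, h2, show y - n * (2 * Real.pi) = 2 * (y / 2 - n * Real.pi) by ring, abs_mul,
    abs_two]
  calc 2 * |y / 2 - n * Real.pi| = Real.pi * (2 / Real.pi * |y / 2 - n * Real.pi|) := by
        field_simp
    _ ≤ Real.pi * |Real.sin (y / 2 - n * Real.pi)| := by gcongr
    _ = _ := by ring

theorem dist_le_mul_norm_fourier_sub (s t : 𝕋) :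
    dist s t ≤ Real.pi / 2 * ‖(fourier 1 s : ℂ) - fourier 1 t‖ := by
  have h : (fourier 1 s : ℂ) = fourier 1 t * fourier 1 (s - t) := by
    simp only [fourier_one]
    rw [← Circle.coe_mul, ← AddCircle.toCircle_add, add_sub_cancel]
  rw [dist_eq_norm, h, ← mul_sub_one, norm_mul, norm_fourier_apply, one_mul]
  exact norm_le_mul_norm_toCircle_sub_one _

/-- Both bounds use `1 - r² ≤ 2(1 - r)`. The denominator is at least `(1 - r)²`, which controls
points near `t`, and also at least `(dist s t / π)²`, which controls points far away. -/
theorem diskPoisson_le_of_le {r : ℝ} (h0 : 0 ≤ r) (hr : r < 1) (s t : 𝕋) :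
    diskPoisson (r * fourier 1 t) s ≤ 2 / (1 - r) ∧
    diskPoisson (r * fourier 1 t) s * dist s t ^ 2 ≤ 2 * Real.pi ^ 2 * (1 - r) := by
  have hδ : 0 < 1 - r := by linarith
  set e : ℂ := fourier 1 s with he
  set e' : ℂ := fourier 1 t with he'
  have hne : ‖e‖ = 1 := norm_fourier_apply _ _
  have hne' : ‖e'‖ = 1 := norm_fourier_apply _ _
  have hz : ‖(r : ℂ) * e'‖ = r := by
    rw [norm_mul, hne', mul_one, Complex.norm_real, Real.norm_of_nonneg h0]
  have h1 : 1 - r ≤ ‖e - r * e'‖ := by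
    have := norm_sub_norm_le e (r * e')
    rwa [hne, hz] at this
  have h2 : ‖e - e'‖ ≤ 2 * ‖e - r * e'‖ := by
    have h3 : ‖e - e'‖ ≤ ‖e - r * e'‖ + ‖r * e' - e'‖ := by
      have := norm_add_le (e - r * e') (r * e' - e')
      rwa [sub_add_sub_cancel] at this
    have h4 : ‖r * e' - e'‖ = 1 - r := by
      rw [show (r : ℂ) * e' - e' = ((r - 1 : ℝ) : ℂ) * e' by push_cast; ring, norm_mul, hne',
        mul_one, Complex.norm_real, Real.norm_of_nonpos (by linarith)]
      ring
    linarith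
  have hd : dist s t ≤ Real.pi * ‖e - r * e'‖ := by
    have := dist_le_mul_norm_fourier_sub s t
    nlinarith [Real.pi_pos]
  have hpos : 0 < ‖e - r * e'‖ := hδ.trans_le h1
  rw [diskPoisson_eq, hz, ← he]
  constructor
  · rw [div_le_div_iff₀ (by positivity) hδ]
    have : (1 - r) ^ 2 ≤ ‖e - r * e'‖ ^ 2 := by gcongr
    nlinarith
  · rw [div_mul_eq_mul_div, div_le_iff₀ (by positivity)]
    have h5 : dist s t ^ 2 ≤ (Real.pi * ‖e - r * e'‖) ^ 2 := by gcongr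
    calc (1 - r ^ 2) * dist s t ^ 2 ≤ (1 - r ^ 2) * (Real.pi * ‖e - r * e'‖) ^ 2 := by
          have : 0 ≤ 1 - r ^ 2 := by nlinarith
          gcongr
      _ ≤ (2 * (1 - r)) * (Real.pi * ‖e - r * e'‖) ^ 2 := by
          gcongr; nlinarith
      _ = _ := by ring

end Poisson

/-! ### Fatou's theorem at Lebesgue points. -/

section Fatou

variable {E : Type*} [NormedAddCommGroup E]

theorem ae_tendsto_ball_mean_norm_sub {f : 𝕋 → E} (hf : Integrable f μ) :
    ∀ᵐ t ∂μ, Tendsto (fun ρ : ℝ => ρ⁻¹ * ∫ s in Metric.closedBall t ρ, ‖f s - f t‖ ∂μ)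
      (𝓝[>] 0) (𝓝 0) := by
  have hvol : (volume : Measure 𝕋) = ENNReal.ofReal (2 * Real.pi) • μ :=
    AddCircle.volume_eq_smul_haarAddCircle
  have hf' : Integrable f (volume : Measure 𝕋) := by
    rw [hvol]; exact hf.smul_measure ENNReal.ofReal_ne_top
  have h := IsUnifLocDoublingMeasure.ae_tendsto_average_norm_sub (volume : Measure 𝕋)
    hf'.locallyIntegrable 1
  have hac : μ ≪ (volume : Measure 𝕋) := by
    rw [hvol]
    exact Measure.absolutelyContinuous_smul (by simp [Real.pi_pos])
  filter_upwards [hac.ae_le h] with t ht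
  have h1 := ht (l := 𝓝[>] (0 : ℝ)) (fun _ => t) (fun ρ => ρ) tendsto_id (by
    filter_upwards [self_mem_nhdsWithin] with ρ hρ
    exact Metric.mem_closedBall_self (by rw [one_mul]; exact le_of_lt hρ))
  -- For small `ρ` the ball has normalized measure `ρ/π`, which accounts for the factor `π⁻¹`.
  have h2 : Tendsto (fun ρ : ℝ => Real.pi⁻¹ *
      ⨍ s in Metric.closedBall t ρ, ‖f s - f t‖ ∂(volume : Measure 𝕋)) (𝓝[>] 0) (𝓝 0) := by
    simpa using h1.const_mul Real.pi⁻¹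
  refine h2.congr' ?_
  have hpi := Real.pi_pos
  filter_upwards [Ioo_mem_nhdsGT hpi] with ρ hρ
  have h3 : (volume : Measure 𝕋).real (Metric.closedBall t ρ) = 2 * ρ := by
    rw [measureReal_def, AddCircle.volume_closedBall, min_eq_right (by linarith [hρ.2]),
      ENNReal.toReal_ofReal (by linarith [hρ.1])]
  rw [setAverage_eq, h3, hvol, Measure.restrict_smul, integral_smul_measure,
    ENNReal.toReal_ofReal (by positivity), smul_eq_mul, smul_eq_mul]
  have := hρ.1.ne'
  field_simp

/-- Dyadic majorant by balls. If `k` is the least index whose ball contains `s`, the `k`-th term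
alone suffices: for `k = 0` by the near bound, for `k ≥ 1` by the far bound with `dist s t > 2^(k-1)
(1 - r)`, which produces `8π²`. The condition on `K` makes the largest ball the whole circle. -/
theorem diskPoisson_le_sum {r : ℝ} (h0 : 0 ≤ r) (hr : r < 1) (s t : 𝕋) {K : ℕ}
    (hK : Real.pi ≤ 2 ^ K * (1 - r)) :
    diskPoisson (r * fourier 1 t) s ≤ ∑ k ∈ Finset.range (K + 1),
      8 * Real.pi ^ 2 * (1 / 2) ^ k * (2 ^ k * (1 - r))⁻¹ *
        (Metric.closedBall t (2 ^ k * (1 - r))).indicator (fun _ => (1 : ℝ)) s := by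
  obtain ⟨hP1, hP2⟩ := diskPoisson_le_of_le h0 hr s t
  have hδ : 0 < 1 - r := by linarith
  have hpi := Real.pi_gt_three
  have hex : ∃ k, dist s t ≤ 2 ^ k * (1 - r) := by
    refine ⟨K, le_trans ?_ hK⟩
    have := AddCircle.norm_le_half_period (2 * Real.pi) (x := s - t) (by positivity)
    rw [dist_eq_norm]
    rwa [abs_of_pos (by positivity), mul_div_cancel_left₀ _ two_ne_zero] at this
  classical
  set k := Nat.find hex with hk
  have hk1 : dist s t ≤ 2 ^ k * (1 - r) := Nat.find_spec hex
  have hkK : k ≤ K := by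
    refine Nat.find_min' hex (le_trans ?_ hK)
    have := AddCircle.norm_le_half_period (2 * Real.pi) (x := s - t) (by positivity)
    rw [dist_eq_norm]
    rwa [abs_of_pos (by positivity), mul_div_cancel_left₀ _ two_ne_zero] at this
  refine le_trans ?_ (Finset.single_le_sum (fun i _ => ?_)
    (Finset.mem_range.2 (Nat.lt_succ_of_le hkK)))
  · rw [Set.indicator_of_mem (Metric.mem_closedBall.2 hk1), mul_one]
    rcases Nat.eq_zero_or_pos k with h | h
    · rw [h, pow_zero, pow_zero, mul_one, one_mul, ← div_eq_mul_inv]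
      refine hP1.trans ?_
      gcongr
      nlinarith
    · obtain ⟨j, hj⟩ := Nat.exists_eq_succ_of_ne_zero h.ne'
      have hj1 : 2 ^ j * (1 - r) < dist s t := by
        have := Nat.find_min hex (m := j) (by omega)
        rwa [not_le] at this
      have hp : (0 : ℝ) < 2 ^ j * (1 - r) := by positivity
      have h4 : diskPoisson (r * fourier 1 t) s ≤
          2 * Real.pi ^ 2 * (1 - r) / (2 ^ j * (1 - r)) ^ 2 := by
        rw [le_div_iff₀ (by positivity)]
        refine le_trans (mul_le_mul_of_nonneg_left ?_ ?_) hP2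
        · gcongr
        · refine diskPoisson_nonneg ?_ s
          rw [norm_mul, norm_fourier_apply, mul_one, Complex.norm_real, Real.norm_of_nonneg h0]
          exact hr
      refine h4.trans (le_of_eq ?_)
      rw [hj, Nat.succ_eq_add_one, pow_succ, pow_succ, one_div, inv_pow]
      field_simp
      ring
  · have : (0 : ℝ) ≤ (Metric.closedBall t (2 ^ i * (1 - r))).indicator (fun _ => (1 : ℝ)) s :=
      Set.indicator_nonneg (fun _ _ => zero_le_one) _
    positivity

theorem norm_mul_fourier {r : ℝ} (h0 : 0 ≤ r) (t : 𝕋) : ‖(r : ℂ) * fourier 1 t‖ = r := by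
  rw [norm_mul, norm_fourier_apply, mul_one, Complex.norm_real, Real.norm_of_nonneg h0]

theorem integral_diskPoisson_mul_le {g : 𝕋 → ℝ} (hg : Integrable g μ) (hg0 : ∀ s, 0 ≤ g s)
    {r : ℝ} (h0 : 0 ≤ r) (hr : r < 1) (t : 𝕋)
    (hs : Summable fun k : ℕ => 8 * Real.pi ^ 2 * (1 / 2) ^ k *
      ((2 ^ k * (1 - r))⁻¹ * ∫ s in Metric.closedBall t (2 ^ k * (1 - r)), g s ∂μ)) :
    ∫ s, diskPoisson (r * fourier 1 t) s * g s ∂μ ≤ ∑' k : ℕ, 8 * Real.pi ^ 2 * (1 / 2) ^ k *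
      ((2 ^ k * (1 - r))⁻¹ * ∫ s in Metric.closedBall t (2 ^ k * (1 - r)), g s ∂μ) := by
  have hδ : 0 < 1 - r := by linarith
  obtain ⟨K, hK⟩ := pow_unbounded_of_one_lt (Real.pi / (1 - r)) one_lt_two
  have hK' : Real.pi ≤ 2 ^ K * (1 - r) := ((div_lt_iff₀ hδ).1 hK).le
  refine le_trans ?_ (hs.sum_le_tsum (Finset.range (K + 1)) fun k _ => ?_)
  · have hz : ‖(r : ℂ) * fourier 1 t‖ < 1 := by rwa [norm_mul_fourier h0]
    have hi : ∀ k : ℕ, Integrable (fun s => 8 * Real.pi ^ 2 * (1 / 2) ^ k * (2 ^ k * (1 - r))⁻¹ *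
        (Metric.closedBall t (2 ^ k * (1 - r))).indicator g s) μ := fun k =>
      (hg.indicator measurableSet_closedBall).const_mul _
    have h1 : ∫ s, diskPoisson (r * fourier 1 t) s * g s ∂μ ≤
        ∫ s, ∑ k ∈ Finset.range (K + 1), 8 * Real.pi ^ 2 * (1 / 2) ^ k * (2 ^ k * (1 - r))⁻¹ *
          (Metric.closedBall t (2 ^ k * (1 - r))).indicator g s ∂μ := by
      refine integral_mono_of_nonneg
        (Eventually.of_forall fun s => mul_nonneg (diskPoisson_nonneg hz s) (hg0 s))
        (integrable_finsetSum _ fun k _ => hi k) (Eventually.of_forall fun s => ?_)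
      refine (mul_le_mul_of_nonneg_right (diskPoisson_le_sum h0 hr s t hK') (hg0 s)).trans
        (le_of_eq ?_)
      rw [Finset.sum_mul]
      refine Finset.sum_congr rfl fun k _ => ?_
      by_cases hsk : s ∈ Metric.closedBall t (2 ^ k * (1 - r))
      · simp only [Set.indicator_of_mem hsk, mul_one]
      · simp only [Set.indicator_of_notMem hsk, mul_zero, zero_mul]
    rw [integral_finsetSum _ fun k _ => hi k] at h1
    refine h1.trans (le_of_eq (Finset.sum_congr rfl fun k _ => ?_))
    rw [integral_const_mul, integral_indicator measurableSet_closedBall, mul_assoc]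
  · have : 0 ≤ ∫ s in Metric.closedBall t (2 ^ k * (1 - r)), g s ∂μ := integral_nonneg hg0
    positivity

/-- The dyadic majorant turns the integral into a geometrically weighted series of ball means. Each
term tends to `0`, and dominated convergence applies because the means are bounded over all radii.
-/
theorem tendsto_integral_diskPoisson_mul {g : 𝕋 → ℝ} (hg : Integrable g μ) (hg0 : ∀ s, 0 ≤ g s)
    {t : 𝕋} (ht : Tendsto (fun ρ : ℝ => ρ⁻¹ * ∫ s in Metric.closedBall t ρ, g s ∂μ)
      (𝓝[>] 0) (𝓝 0)) :
    Tendsto (fun r : ℝ => ∫ s, diskPoisson (r * fourier 1 t) s * g s ∂μ) (𝓝[<] 1) (𝓝 0) := by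
  set A : ℝ → ℝ := fun ρ => ρ⁻¹ * ∫ s in Metric.closedBall t ρ, g s ∂μ with hA
  have hA0 : ∀ ρ, 0 < ρ → 0 ≤ A ρ := fun ρ hρ =>
    mul_nonneg (inv_nonneg.2 hρ.le) (integral_nonneg hg0)
  -- Small radii are controlled by the limit, large ones by the total integral of `g`.
  obtain ⟨B, hB⟩ : ∃ B, ∀ ρ, 0 < ρ → A ρ ≤ B := by
    have h1 : ∀ᶠ ρ in 𝓝[>] (0 : ℝ), A ρ < 1 := ht.eventually (gt_mem_nhds one_pos)
    obtain ⟨ρ₀, hρ₀, h2⟩ := mem_nhdsGT_iff_exists_Ioo_subset.1 h1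
    refine ⟨max 1 (ρ₀⁻¹ * ∫ s, g s ∂μ), fun ρ hρ => ?_⟩
    rcases lt_or_ge ρ ρ₀ with h | h
    · exact le_max_of_le_left (le_of_lt (h2 ⟨hρ, h⟩))
    · refine le_max_of_le_right ?_
      have hρ₀' : 0 < ρ₀ := hρ₀
      exact mul_le_mul (inv_anti₀ hρ₀' h)
        (setIntegral_le_integral hg (Eventually.of_forall hg0)) (integral_nonneg hg0)
        (inv_nonneg.2 hρ₀'.le)
  have hsum : Summable fun k : ℕ => 8 * Real.pi ^ 2 * (1 / 2) ^ k * B :=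
    ((summable_geometric_of_lt_one (by norm_num) (by norm_num)).mul_left _).mul_right _
  have hbound : ∀ r : ℝ, r < 1 → ∀ k : ℕ,
      ‖8 * Real.pi ^ 2 * (1 / 2) ^ k * A (2 ^ k * (1 - r))‖ ≤ 8 * Real.pi ^ 2 * (1 / 2) ^ k * B := by
    intro r hr k
    have hpos : 0 < 2 ^ k * (1 - r) := mul_pos (by positivity) (by linarith)
    rw [Real.norm_of_nonneg (mul_nonneg (by positivity) (hA0 _ hpos))]
    exact mul_le_mul_of_nonneg_left (hB _ hpos) (by positivity)
  have hlim : Tendsto (fun r : ℝ => ∑' k : ℕ, 8 * Real.pi ^ 2 * (1 / 2) ^ k * A (2 ^ k * (1 - r)))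
      (𝓝[<] 1) (𝓝 (∑' _ : ℕ, (0 : ℝ))) := by
    refine tendsto_tsum_of_dominated_convergence hsum (fun k => ?_) ?_
    · have h1 : Tendsto (fun r : ℝ => 2 ^ k * (1 - r)) (𝓝[<] 1) (𝓝[>] 0) := by
        refine tendsto_nhdsWithin_iff.2 ⟨?_, ?_⟩
        · have : Continuous fun r : ℝ => 2 ^ k * (1 - r) := by fun_prop
          have h2 := this.tendsto 1
          rw [sub_self, mul_zero] at h2
          exact h2.mono_left nhdsWithin_le_nhds
        · filter_upwards [self_mem_nhdsWithin] with r hr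
          exact Set.mem_Ioi.2 (mul_pos (by positivity) (sub_pos.2 hr))
      simpa using (ht.comp h1).const_mul (8 * Real.pi ^ 2 * (1 / 2) ^ k)
    · filter_upwards [self_mem_nhdsWithin] with r hr
      exact hbound r hr
  rw [tsum_zero] at hlim
  have hIoo : ∀ᶠ r : ℝ in 𝓝[<] 1, r ∈ Set.Ioo (0 : ℝ) 1 := Ioo_mem_nhdsLT one_pos
  refine squeeze_zero' ?_ ?_ hlim
  · filter_upwards [hIoo] with r hr
    exact integral_nonneg fun s => mul_nonneg
      (diskPoisson_nonneg (by rw [norm_mul_fourier hr.1.le]; exact hr.2) s) (hg0 s)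
  · filter_upwards [hIoo] with r hr
    exact integral_diskPoisson_mul_le hg hg0 hr.1.le hr.2 t
      (Summable.of_norm_bounded hsum (hbound r hr.2))

variable [NormedSpace ℂ E] [CompleteSpace E]

/-- **Fatou's theorem** on the almost everywhere radial convergence of Poisson integrals. -/
theorem ae_tendsto_integral_diskPoisson {f : 𝕋 → E} (hf : Integrable f μ) :
    ∀ᵐ t ∂μ, Tendsto (fun r : ℝ => ∫ s, (diskPoisson (r * fourier 1 t) s : ℂ) • f s ∂μ)
      (𝓝[<] 1) (𝓝 (f t)) := by
  filter_upwards [ae_tendsto_ball_mean_norm_sub hf] with t ht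
  have hi : Integrable (fun s => f s - f t) μ := hf.sub (integrable_const _)
  refine tendsto_iff_norm_sub_tendsto_zero.2 (squeeze_zero' (Eventually.of_forall fun r =>
    norm_nonneg _) ?_ (tendsto_integral_diskPoisson_mul hi.norm (fun s => norm_nonneg _) ht))
  have hIoo : ∀ᶠ r : ℝ in 𝓝[<] 1, r ∈ Set.Ioo (0 : ℝ) 1 := Ioo_mem_nhdsLT one_pos
  filter_upwards [hIoo] with r hr
  have hz : ‖(r : ℂ) * fourier 1 t‖ < 1 := by rw [norm_mul_fourier hr.1.le]; exact hr.2
  have h1 : ∫ s, (diskPoisson (r * fourier 1 t) s : ℂ) • f t ∂μ = f t := by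
    rw [integral_smul_const, integral_complex_ofReal, integral_diskPoisson hz, Complex.ofReal_one,
      one_smul]
  have h2 : (∫ s, (diskPoisson (r * fourier 1 t) s : ℂ) • f s ∂μ) - f t =
      ∫ s, (diskPoisson (r * fourier 1 t) s : ℂ) • (f s - f t) ∂μ := by
    conv_lhs => rw [← h1]
    rw [← integral_sub (integrable_diskPoisson_smul hz hf)
      (integrable_diskPoisson_smul hz (integrable_const _))]
    simp only [smul_sub]
  rw [h2]
  refine (norm_integral_le_integral_norm _).trans (le_of_eq ?_)
  refine integral_congr_ae (Eventually.of_forall fun s => ?_)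
  beta_reduce
  rw [norm_smul, Complex.norm_real, Real.norm_of_nonneg (diskPoisson_nonneg hz s)]

end Fatou

/-! ### Isometric multiplication operators, and analytic functions on circles. -/

section Multiplication

variable {E : Type*} [NormedAddCommGroup E] [InnerProductSpace ℂ E] [CompleteSpace E]
variable {F : Type*} [NormedAddCommGroup F] [InnerProductSpace ℂ F] [CompleteSpace F]

theorem memLp_isometry_apply {Ψ : 𝕋 → F →L[ℂ] E}
    (hm : ∀ v : F, AEStronglyMeasurable (fun t => Ψ t v) μ) (hi : ∀ᵐ t ∂μ, Isometry (Ψ t))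
    (f : L2 F) : MemLp (fun t => Ψ t (f t)) 2 μ := by
  refine MemLp.of_le (Lp.memLp f) (aestronglyMeasurable_apply hm (Lp.aestronglyMeasurable f)) ?_
  filter_upwards [hi] with t ht
  exact ((AddMonoidHomClass.isometry_iff_norm (Ψ t)).1 ht _).le

/-- Multiplication by an operator-valued function whose values are isometries. -/
noncomputable def isometricMultiplication {Ψ : 𝕋 → F →L[ℂ] E}
    (hm : ∀ v : F, AEStronglyMeasurable (fun t => Ψ t v) μ) (hi : ∀ᵐ t ∂μ, Isometry (Ψ t)) :
    L2 F →ₗᵢ[ℂ] L2 E where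
  toFun f := (memLp_isometry_apply hm hi f).toLp _
  map_add' f g := by
    rw [← MemLp.toLp_add]
    refine MemLp.toLp_congr _ _ ?_
    filter_upwards [Lp.coeFn_add f g] with t ht
    rw [ht, Pi.add_apply, map_add, Pi.add_apply]
  map_smul' c f := by
    rw [RingHom.id_apply, ← MemLp.toLp_const_smul]
    refine MemLp.toLp_congr _ _ ?_
    filter_upwards [Lp.coeFn_smul c f] with t ht
    rw [ht, Pi.smul_apply, map_smul, Pi.smul_apply]
  norm_map' f := by
    change ‖(memLp_isometry_apply hm hi f).toLp _‖ = _
    rw [Lp.norm_toLp, Lp.norm_def]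
    congr 1
    refine eLpNorm_congr_norm_ae ?_
    filter_upwards [hi] with t ht
    exact (AddMonoidHomClass.isometry_iff_norm (Ψ t)).1 ht _

theorem coeFn_isometricMultiplication {Ψ : 𝕋 → F →L[ℂ] E}
    (hm : ∀ v : F, AEStronglyMeasurable (fun t => Ψ t v) μ) (hi : ∀ᵐ t ∂μ, Isometry (Ψ t))
    (f : L2 F) : isometricMultiplication hm hi f =ᵐ[μ] fun t => Ψ t (f t) :=
  (memLp_isometry_apply hm hi f).coeFn_toLp

/-- The mean value property applied to `z^(k+1) g(z)`, which vanishes at the origin. -/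
theorem fourierCoeff_circle_eq_zero {g : ℂ → E} (hg : DifferentiableOn ℂ g (Metric.ball 0 1))
    {r : ℝ} (h0 : 0 < r) (hr : r < 1) {n : ℤ} (hn : n < 0) :
    fourierCoeff (fun t : 𝕋 => g (r * fourier 1 t)) n = 0 := by
  obtain ⟨k, rfl⟩ : ∃ k : ℕ, n = -((k + 1 : ℕ) : ℤ) := by
    obtain ⟨m, hm⟩ := Int.exists_eq_neg_ofNat hn.le
    cases m with
    | zero => simp [hm] at hn
    | succ k => exact ⟨k, hm⟩
  have hd : DifferentiableOn ℂ (fun z => z ^ (k + 1) • g z) (Metric.closedBall 0 |r|) := by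
    refine DifferentiableOn.smul (by fun_prop) (hg.mono ?_)
    rw [abs_of_pos h0]
    exact Metric.closedBall_subset_ball hr
  have h1 := hd.diffContOnCl_ball (c := 0) (R := |r|) subset_rfl |>.circleAverage
  rw [zero_pow (Nat.succ_ne_zero k), zero_smul, Real.circleAverage] at h1
  rw [fourierCoeff_eq_intervalIntegral _ _ 0, neg_neg, zero_add]
  have h2 : ∀ θ : ℝ, circleMap 0 r θ ^ (k + 1) • g (circleMap 0 r θ) =
      (r : ℂ) ^ (k + 1) • ((fourier ((k + 1 : ℕ) : ℤ) (θ : 𝕋) : ℂ) • g (r * fourier 1 (θ : 𝕋))) := by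
    intro θ
    have h3 : circleMap 0 r θ = r * fourier 1 (θ : 𝕋) := by
      rw [circleMap, zero_add, fourier_coe_apply]
      congr 2
      have : (Real.pi : ℂ) ≠ 0 := by exact_mod_cast Real.pi_ne_zero
      push_cast
      field_simp
    rw [h3, fourier_natCast, mul_pow, smul_smul]
  simp only [h2] at h1
  rw [intervalIntegral.integral_smul, smul_comm, smul_eq_zero] at h1
  rw [one_div]
  exact h1.resolve_left (pow_ne_zero _ (by exact_mod_cast h0.ne'))

end Multiplication

/-! ### From an inner function to a subspace: `S = Θ H²_F`. -/

section Inner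

variable {E : Type*} [NormedAddCommGroup E] [InnerProductSpace ℂ E] [CompleteSpace E]
variable {F : Type*} [NormedAddCommGroup F] [InnerProductSpace ℂ F] [CompleteSpace F]

/-- A sequence of radii is needed for measurability of limits and for dominated convergence; the
shift by `2` keeps every radius positive. -/
theorem tendsto_one_sub_one_div :
    Tendsto (fun n : ℕ => 1 - 1 / ((n : ℝ) + 2)) atTop (𝓝[<] 1) := by
  refine tendsto_nhdsWithin_iff.2 ⟨?_, Eventually.of_forall fun n => ?_⟩
  · have h : Tendsto (fun n : ℕ => 1 / ((n : ℝ) + 2)) atTop (𝓝 0) := by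
      have := (tendsto_one_div_add_atTop_nhds_zero_nat (𝕜 := ℝ)).comp (tendsto_add_atTop_nat 1)
      refine this.congr fun n => ?_
      simp only [Function.comp_apply]
      push_cast
      ring
    simpa using h.const_sub 1
  · have : (0 : ℝ) < 1 / ((n : ℝ) + 2) := by positivity
    simp only [Set.mem_Iio]
    linarith

theorem one_sub_one_div_mem (n : ℕ) : 1 - 1 / ((n : ℝ) + 2) ∈ Set.Ioo (0 : ℝ) 1 := by
  have h1 : (0 : ℝ) < 1 / ((n : ℝ) + 2) := by positivity
  have h2 : 1 / ((n : ℝ) + 2) < 1 := by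
    rw [div_lt_one (by positivity)]
    have : (0 : ℝ) ≤ n := n.cast_nonneg
    linarith
  constructor <;> linarith

theorem mem_ball_of_mem_Ioo {r : ℝ} (hr : r ∈ Set.Ioo (0 : ℝ) 1) (t : 𝕋) :
    (r : ℂ) * fourier 1 t ∈ Metric.ball (0 : ℂ) 1 := by
  rw [mem_ball_zero_iff, norm_mul_fourier hr.1.le]
  exact hr.2

theorem IsHInfty.continuous_circle {Θ : ℂ → F →L[ℂ] E} (hΘ : IsHInfty Θ) {r : ℝ}
    (hr : r ∈ Set.Ioo (0 : ℝ) 1) (v : F) :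
    Continuous fun t : 𝕋 => Θ ((r : ℂ) * fourier 1 t) v := by
  have h1 : Continuous fun t : 𝕋 => Θ ((r : ℂ) * fourier 1 t) :=
    hΘ.analytic.continuousOn.comp_continuous (continuous_const.mul (fourier 1).continuous)
      (mem_ball_of_mem_Ioo hr)
  exact h1.clm_apply continuous_const

theorem IsInner.aestronglyMeasurable {Θ : ℂ → F →L[ℂ] E} {Θb : 𝕋 → F →L[ℂ] E}
    (h : IsInner Θ Θb) (v : F) : AEStronglyMeasurable (fun t => Θb t v) μ := by
  refine aestronglyMeasurable_of_tendsto_ae atTop (fun n : ℕ =>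
    (h.hInfty.continuous_circle (one_sub_one_div_mem n) v).aestronglyMeasurable) ?_
  filter_upwards [h.boundary] with t ht
  exact (ht v).comp tendsto_one_sub_one_div

theorem IsInner.fourierCoeff_eq_zero {Θ : ℂ → F →L[ℂ] E} {Θb : 𝕋 → F →L[ℂ] E}
    (h : IsInner Θ Θb) (v : F) {n : ℤ} (hn : n < 0) : fourierCoeff (fun t => Θb t v) n = 0 := by
  obtain ⟨C, hC⟩ := h.hInfty.bdd
  have hlim : Tendsto (fun m : ℕ => fourierCoeff (fun t : 𝕋 =>
      Θ (((1 - 1 / ((m : ℝ) + 2) : ℝ) : ℂ) * fourier 1 t) v) n) atTop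
      (𝓝 (fourierCoeff (fun t => Θb t v) n)) := by
    unfold fourierCoeff
    refine tendsto_integral_of_dominated_convergence (fun _ => C * ‖v‖) (fun m => ?_)
      (integrable_const _) (fun m => Eventually.of_forall fun t => ?_) ?_
    · exact ((fourier (-n)).continuous.smul
        (h.hInfty.continuous_circle (one_sub_one_div_mem m) v)).aestronglyMeasurable
    · rw [norm_smul, norm_fourier_apply, one_mul]
      exact (ContinuousLinearMap.le_opNorm _ _).trans
        (mul_le_mul_of_nonneg_right (hC _ (mem_ball_of_mem_Ioo (one_sub_one_div_mem m) t))
          (norm_nonneg _))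
    · filter_upwards [h.boundary] with t ht
      exact ((ht v).comp tendsto_one_sub_one_div).const_smul _
  refine tendsto_nhds_unique hlim ?_
  refine tendsto_const_nhds.congr fun m => ?_
  have hm := one_sub_one_div_mem m
  exact (fourierCoeff_circle_eq_zero (g := fun z => Θ z v)
    (h.hInfty.analytic.clm_apply (differentiableOn_const v)) hm.1 hm.2 hn).symm

theorem IsInner.multiplication_mem_H2 {Θ : ℂ → F →L[ℂ] E} {Θb : 𝕋 → F →L[ℂ] E}
    (h : IsInner Θ Θb) (f : H2 F) :
    isometricMultiplication h.aestronglyMeasurable h.isometry (f : L2 F) ∈ H2 E := by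
  intro n hn
  set J := isometricMultiplication h.aestronglyMeasurable h.isometry
  -- By continuity it suffices to test on monomials `zᵏ v`, where the coefficient is that of `Θ v`
  -- at `n - k < 0`.
  have key : (coeffL E n) ∘L J.toContinuousLinearMap ∘L (H2 F).subtypeL = 0 := by
    refine IsHilbertSum.eq_of_forall_apply isHilbertSum_hardyMonomial fun k v => ?_
    change fourierCoeff (J (monomial F k v)) n = 0
    have h1 : J (monomial F k v) =ᵐ[μ] fun t => (fourier k t : ℂ) • Θb t v := by
      filter_upwards [coeFn_isometricMultiplication h.aestronglyMeasurable h.isometry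
        (monomial F k v), coeFn_monomial (k : ℤ) v] with t h1 h2
      rw [h1, h2, map_smul]
    rw [fourierCoeff_congr_ae h1, fourierCoeff_fourier_smul_apply]
    exact h.fourierCoeff_eq_zero v (by omega)
  exact congrArg (fun T : H2 F →L[ℂ] E => T f) key

/-- Multiplication by an inner function, as an isometry between Hardy spaces. -/
noncomputable def IsInner.mul {Θ : ℂ → F →L[ℂ] E} {Θb : 𝕋 → F →L[ℂ] E} (h : IsInner Θ Θb) :
    H2 F →ₗᵢ[ℂ] H2 E where
  toLinearMap := ((isometricMultiplication h.aestronglyMeasurable h.isometry).toLinearMap ∘ₗ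
    (H2 F).subtype).codRestrict (H2 E) h.multiplication_mem_H2
  norm_map' f := (isometricMultiplication h.aestronglyMeasurable h.isometry).norm_map f

theorem IsInner.coeFn_mul {Θ : ℂ → F →L[ℂ] E} {Θb : 𝕋 → F →L[ℂ] E} (h : IsInner Θ Θb)
    (f : H2 F) : (h.mul f : L2 E) =ᵐ[μ] fun t => Θb t ((f : L2 F) t) :=
  coeFn_isometricMultiplication h.aestronglyMeasurable h.isometry _

/-- The pointwise relation puts `Φ Θ f = Θ A f` in `H²` already, so the projection acts trivially.
-/
theorem IsInner.toeplitz_mul {Θ : ℂ → F →L[ℂ] E} {Θb : 𝕋 → F →L[ℂ] E} (h : IsInner Θ Θb)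
    {Φ : 𝕋 → E →L[ℂ] E} (hΦ : MemLinfty Φ) {A : F →L[ℂ] F}
    (hA : ∀ᵐ t ∂μ, Φ t ∘L Θb t = Θb t ∘L A) (f : H2 F) :
    toeplitz hΦ (h.mul f) = h.mul (toeplitz (memLinfty_const A) f) := by
  refine toeplitz_eq_of_laurent_eq hΦ (Lp.ext ?_)
  filter_upwards [hA, coeFn_laurent hΦ (h.mul f : L2 E), h.coeFn_mul f,
    h.coeFn_mul (toeplitz (memLinfty_const A) f), coeFn_toeplitz_const A f] with t h1 h2 h3 h4 h5
  rw [h2, h3, h4, h5]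
  exact congrArg (fun T : F →L[ℂ] E => T ((f : L2 F) t)) h1

theorem IsInner.shift_mul {Θ : ℂ → F →L[ℂ] E} {Θb : 𝕋 → F →L[ℂ] E} (h : IsInner Θ Θb)
    (f : H2 F) : shift E (h.mul f) = h.mul (shift F f) := by
  refine Subtype.ext (Lp.ext ?_)
  filter_upwards [coeFn_shift (h.mul f), h.coeFn_mul f, h.coeFn_mul (shift F f),
    coeFn_shift f] with t h1 h2 h3 h4
  rw [h1, h2, h3, h4, map_smul]

theorem toeplitz_const_symm (U : F ≃ₗᵢ[ℂ] F) (f : H2 F) :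
    toeplitz (memLinfty_const (U : F →L[ℂ] F))
      (toeplitz (memLinfty_const (U.symm : F →L[ℂ] F)) f) = f := by
  refine Subtype.ext (Lp.ext ?_)
  filter_upwards [coeFn_toeplitz_const (U : F →L[ℂ] F)
    (toeplitz (memLinfty_const (U.symm : F →L[ℂ] F)) f),
    coeFn_toeplitz_const (U.symm : F →L[ℂ] F) f] with t h1 h2
  rw [h1, h2]
  exact U.apply_symm_apply _

theorem norm_toeplitz_const (U : F ≃ₗᵢ[ℂ] F) (f : H2 F) :
    ‖toeplitz (memLinfty_const (U : F →L[ℂ] F)) f‖ = ‖f‖ := by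
  rw [Submodule.coe_norm, Submodule.coe_norm, Lp.norm_def, Lp.norm_def]
  congr 1
  refine eLpNorm_congr_norm_ae ?_
  filter_upwards [coeFn_toeplitz_const (U : F →L[ℂ] F) f] with t ht
  rw [ht]
  exact U.norm_map _

theorem IsUnitaryOn.of_norm_eq_of_surjOn {H : Type*} [NormedAddCommGroup H] [InnerProductSpace ℂ H]
    [CompleteSpace H] {S : Submodule ℂ H} {T : H →L[ℂ] H} (h1 : ∀ f ∈ S, T f ∈ S)
    (h2 : ∀ f ∈ S, ‖T f‖ = ‖f‖) (h3 : ∀ f ∈ S, ∃ g ∈ S, T g = f) : IsUnitaryOn S T := by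
  refine ⟨LinearIsometryEquiv.ofSurjective
    { toLinearMap := (T : H →ₗ[ℂ] H).restrict h1, norm_map' := fun f => h2 f f.2 } ?_,
    fun f => rfl⟩
  intro f
  obtain ⟨g, hg, hgf⟩ := h3 f f.2
  exact ⟨⟨g, hg⟩, Subtype.ext hgf⟩

theorem IsInner.isShiftInvariantUnitaryPart [Nontrivial F] {Θ : ℂ → F →L[ℂ] E}
    {Θb : 𝕋 → F →L[ℂ] E} (h : IsInner Θ Θb) {Φ : 𝕋 → E →L[ℂ] E} (hΦ : MemLinfty Φ)
    {U : F ≃ₗᵢ[ℂ] F} (h1 : ∀ᵐ t ∂μ, Φ t ∘L Θb t = Θb t ∘L (U : F →L[ℂ] F))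
    (h2 : ∀ᵐ t ∂μ, (Φ t).adjoint ∘L Θb t = Θb t ∘L (U : F →L[ℂ] F).adjoint) :
    IsShiftInvariantUnitaryPart (toeplitz hΦ) (LinearMap.range h.mul.toLinearMap) where
  closed := by
    have : (LinearMap.range h.mul.toLinearMap : Set (H2 E)) = Set.range h.mul := by ext; simp
    rw [this]
    exact h.mul.isometry.isClosedEmbedding.isClosed_range
  ne_bot := by
    obtain ⟨v, hv⟩ := exists_ne (0 : F)
    refine (Submodule.ne_bot_iff _).2 ⟨h.mul (hardyMonomial F 0 v), ⟨_, rfl⟩, fun h0 => hv ?_⟩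
    rw [← norm_eq_zero] at h0 ⊢
    rwa [LinearIsometry.norm_map, LinearIsometry.norm_map] at h0
  shift_mem := by
    rintro _ ⟨f, rfl⟩
    exact ⟨shift F f, (h.shift_mul f).symm⟩
  reduces :=
    { map_mem := by
        rintro _ ⟨f, rfl⟩
        exact ⟨_, (h.toeplitz_mul hΦ h1 f).symm⟩
      adjoint_map_mem := by
        rintro _ ⟨f, rfl⟩
        rw [adjoint_toeplitz]
        exact ⟨_, (h.toeplitz_mul hΦ.adjoint h2 f).symm⟩ }
  unitary := by
    refine IsUnitaryOn.of_norm_eq_of_surjOn ?_ ?_ ?_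
    · rintro _ ⟨f, rfl⟩
      exact ⟨_, (h.toeplitz_mul hΦ h1 f).symm⟩
    · rintro _ ⟨f, rfl⟩
      change ‖toeplitz hΦ (h.mul f)‖ = ‖h.mul f‖
      rw [h.toeplitz_mul hΦ h1, LinearIsometry.norm_map, LinearIsometry.norm_map,
        norm_toeplitz_const]
    · rintro _ ⟨f, rfl⟩
      refine ⟨_, ⟨toeplitz (memLinfty_const (U.symm : F →L[ℂ] F)) f, rfl⟩, ?_⟩
      change toeplitz hΦ (h.mul _) = h.mul f
      rw [h.toeplitz_mul hΦ h1, toeplitz_const_symm]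

end Inner

/-! ### From a wandering subspace to an inner function. -/

section RadialExtension

variable {E : Type*} [NormedAddCommGroup E] [InnerProductSpace ℂ E] [CompleteSpace E]
variable {G : Type*} [NormedAddCommGroup G] [InnerProductSpace ℂ G] [CompleteSpace G]

theorem norm_pow_smul_le {X : Type*} [NormedAddCommGroup X] [NormedSpace ℂ X] {c : ℕ → X}
    (hc : ∀ n, ‖c n‖ ≤ 1) {z : ℂ} {r : ℝ} (hz : ‖z‖ ≤ r) (n : ℕ) : ‖z ^ n • c n‖ ≤ r ^ n := by
  rw [norm_smul, norm_pow]
  have h0 : 0 ≤ r := (norm_nonneg z).trans hz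
  calc ‖z‖ ^ n * ‖c n‖ ≤ r ^ n * 1 :=
        mul_le_mul (pow_le_pow_left₀ (norm_nonneg z) hz n) (hc n) (norm_nonneg _) (pow_nonneg h0 n)
    _ = r ^ n := mul_one _

theorem summable_pow_smul {X : Type*} [NormedAddCommGroup X] [NormedSpace ℂ X] [CompleteSpace X]
    {c : ℕ → X} (hc : ∀ n, ‖c n‖ ≤ 1) {z : ℂ} (hz : ‖z‖ < 1) : Summable fun n => z ^ n • c n :=
  Summable.of_norm_bounded (summable_geometric_of_lt_one (norm_nonneg _) hz)
    (norm_pow_smul_le hc le_rfl)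

theorem differentiableOn_tsum_pow_smul {X : Type*} [NormedAddCommGroup X] [NormedSpace ℂ X]
    [CompleteSpace X] {c : ℕ → X} (hc : ∀ n, ‖c n‖ ≤ 1) :
    DifferentiableOn ℂ (fun z : ℂ => ∑' n, z ^ n • c n) (Metric.ball 0 1) := by
  intro z hz
  obtain ⟨r, hzr, hr⟩ := exists_between (mem_ball_zero_iff.1 hz)
  have h0 : 0 ≤ r := (norm_nonneg z).trans hzr.le
  have h := Complex.differentiableOn_tsum_of_summable_norm (summable_geometric_of_lt_one h0 hr)
    (F := fun n (z : ℂ) => z ^ n • c n) (U := Metric.ball 0 r)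
    (fun n => by fun_prop) Metric.isOpen_ball
    (fun n w hw => norm_pow_smul_le hc (mem_ball_zero_iff.1 hw).le n)
  exact (h.differentiableAt (Metric.isOpen_ball.mem_nhds
    (mem_ball_zero_iff.2 hzr))).differentiableWithinAt

/-- The operators assigning to `v` the Taylor coefficients of the Hardy function `ι v`. -/
noncomputable def taylorCoeff (ι : G →ₗᵢ[ℂ] H2 E) (n : ℕ) : G →L[ℂ] E :=
  coeffL E n ∘L (H2 E).subtypeL ∘L ι.toContinuousLinearMap

theorem taylorCoeff_apply (ι : G →ₗᵢ[ℂ] H2 E) (n : ℕ) (v : G) :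
    taylorCoeff ι n v = fourierCoeff (ι v : L2 E) n := rfl

theorem norm_taylorCoeff_le (ι : G →ₗᵢ[ℂ] H2 E) (n : ℕ) : ‖taylorCoeff ι n‖ ≤ 1 := by
  refine ContinuousLinearMap.opNorm_le_bound _ zero_le_one fun v => ?_
  rw [taylorCoeff_apply, one_mul, ← ι.norm_map v]
  exact norm_fourierCoeff_le _ _

/-- The operator-valued analytic function `z ↦ (v ↦ (ι v)(z))` on the unit disc. -/
noncomputable def analyticExtension (ι : G →ₗᵢ[ℂ] H2 E) (z : ℂ) : G →L[ℂ] E :=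
  ∑' n, z ^ n • taylorCoeff ι n

theorem analyticExtension_apply (ι : G →ₗᵢ[ℂ] H2 E) {z : ℂ} (hz : ‖z‖ < 1) (v : G) :
    analyticExtension ι z v = ∫ t, (diskPoisson z t : ℂ) • (ι v : L2 E) t ∂μ := by
  have h1 := (summable_pow_smul (norm_taylorCoeff_le ι) hz).hasSum.mapL
    (ContinuousLinearMap.apply ℂ E v)
  exact h1.unique (hasSum_integral_diskPoisson hz (integrable_L2 _) (ι v).2)

theorem ae_tendsto_analyticExtension (ι : G →ₗᵢ[ℂ] H2 E) (v : G) :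
    ∀ᵐ t ∂μ, Tendsto (fun r : ℝ => analyticExtension ι (r * fourier 1 t) v) (𝓝[<] 1)
      (𝓝 ((ι v : L2 E) t)) := by
  filter_upwards [ae_tendsto_integral_diskPoisson (integrable_L2 (ι v : L2 E))] with t ht
  refine ht.congr' ?_
  have hIoo : ∀ᶠ r : ℝ in 𝓝[<] 1, r ∈ Set.Ioo (0 : ℝ) 1 := Ioo_mem_nhdsLT one_pos
  filter_upwards [hIoo] with r hr
  rw [analyticExtension_apply]
  exact mem_ball_zero_iff.1 (mem_ball_of_mem_Ioo hr t)

/-- Uniqueness for `L¹`, needed because pointwise inner products of `L²` functions are merely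
integrable: all Poisson integrals vanish, and Fatou's theorem recovers `f` from them. -/
theorem ae_eq_zero_of_forall_fourierCoeff {X : Type*} [NormedAddCommGroup X] [NormedSpace ℂ X]
    [CompleteSpace X] {f : 𝕋 → X} (hf : Integrable f μ) (h : ∀ n, fourierCoeff f n = 0) :
    f =ᵐ[μ] 0 := by
  filter_upwards [ae_tendsto_integral_diskPoisson hf] with t ht
  refine tendsto_nhds_unique ht (tendsto_const_nhds.congr' ?_)
  have hIoo : ∀ᶠ r : ℝ in 𝓝[<] 1, r ∈ Set.Ioo (0 : ℝ) 1 := Ioo_mem_nhdsLT one_pos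
  filter_upwards [hIoo] with r hr
  have h1 := hasSum_integral_diskPoisson (mem_ball_zero_iff.1 (mem_ball_of_mem_Ioo hr t)) hf
    fun n _ => h n
  simp only [h, smul_zero] at h1
  exact (h1.unique hasSum_zero).symm

theorem inner_shift_pow_right (f g : H2 E) (n : ℕ) :
    inner ℂ f ((shift E ^ n) g) =
      ∫ t, (fourier n t : ℂ) • (inner ℂ ((f : L2 E) t) ((g : L2 E) t) : ℂ) ∂μ := by
  rw [Submodule.coe_inner, L2.inner_def]
  refine integral_congr_ae ?_
  filter_upwards [coeFn_shift_pow n g] with t ht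
  rw [ht, inner_smul_right, smul_eq_mul]

theorem inner_shift_pow_left (f g : H2 E) (n : ℕ) :
    inner ℂ ((shift E ^ n) f) g =
      ∫ t, (fourier (-(n : ℤ)) t : ℂ) • (inner ℂ ((f : L2 E) t) ((g : L2 E) t) : ℂ) ∂μ := by
  rw [Submodule.coe_inner, L2.inner_def]
  refine integral_congr_ae ?_
  filter_upwards [coeFn_shift_pow n f] with t ht
  rw [ht, inner_smul_left, smul_eq_mul, fourier_neg]

/-- The Fourier coefficients of `‖f(t)‖²` are the inner products of `f` with its shifts, on one side
or the other; only the zeroth survives, and it equals `‖f‖²`. -/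
theorem ae_norm_eq_of_inner_shift_pow {f : H2 E}
    (h : ∀ n : ℕ, inner ℂ ((shift E ^ (n + 1)) f) f = 0) :
    ∀ᵐ t ∂μ, ‖(f : L2 E) t‖ = ‖f‖ := by
  have hq : Integrable (fun t => (inner ℂ ((f : L2 E) t) ((f : L2 E) t) : ℂ)) μ :=
    L2.integrable_inner (𝕜 := ℂ) (f : L2 E) (f : L2 E)
  have hz : (fun t => (inner ℂ ((f : L2 E) t) ((f : L2 E) t) : ℂ) - (‖f‖ : ℂ) ^ 2) =ᵐ[μ] 0 := by
    refine ae_eq_zero_of_forall_fourierCoeff (hq.sub (integrable_const _)) fun n => ?_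
    have hc : fourierCoeff (fun _ : 𝕋 => (‖f‖ : ℂ) ^ 2) n = if n = 0 then (‖f‖ : ℂ) ^ 2 else 0 := by
      have := fourierCoeff_fourier_smul 0 n ((‖f‖ : ℂ) ^ 2)
      simpa using this
    have hsub : fourierCoeff (fun t => (inner ℂ ((f : L2 E) t) ((f : L2 E) t) : ℂ) -
        (‖f‖ : ℂ) ^ 2) n = fourierCoeff (fun t => (inner ℂ ((f : L2 E) t) ((f : L2 E) t) : ℂ)) n -
        fourierCoeff (fun _ : 𝕋 => (‖f‖ : ℂ) ^ 2) n := by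
      unfold fourierCoeff
      rw [← integral_sub (hq.fourier_smul _) ((integrable_const _).fourier_smul _)]
      simp only [smul_sub]
    rw [hsub, hc]
    rcases lt_trichotomy n 0 with hn | rfl | hn
    · obtain ⟨k, rfl⟩ : ∃ k : ℕ, n = -((k + 1 : ℕ) : ℤ) := ⟨(-n - 1).toNat, by omega⟩
      rw [if_neg hn.ne, sub_zero]
      unfold fourierCoeff
      rw [neg_neg, ← inner_shift_pow_right]
      exact inner_eq_zero_symm.1 (h k)
    · rw [if_pos rfl]
      have h0 := inner_shift_pow_right f f 0
      rw [pow_zero] at h0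
      unfold fourierCoeff
      rw [neg_zero]
      erw [← h0]
      exact sub_eq_zero.2 (inner_self_eq_norm_sq_to_K (𝕜 := ℂ) f)
    · obtain ⟨k, rfl⟩ : ∃ k : ℕ, n = ((k + 1 : ℕ) : ℤ) := ⟨(n - 1).toNat, by omega⟩
      rw [if_neg hn.ne', sub_zero]
      unfold fourierCoeff
      rw [← inner_shift_pow_left, h]
  filter_upwards [hz] with t ht
  have h1 : (inner ℂ ((f : L2 E) t) ((f : L2 E) t) : ℂ) = (‖f‖ : ℂ) ^ 2 := sub_eq_zero.1 ht
  have h2 : ‖(f : L2 E) t‖ ^ 2 = ‖f‖ ^ 2 := by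
    rw [← inner_self_eq_norm_sq (𝕜 := ℂ), h1, ← Complex.ofReal_pow]
    rfl
  exact (pow_left_inj₀ (norm_nonneg _) (norm_nonneg _) two_ne_zero).1 h2

theorem norm_analyticExtension_le {ι : G →ₗᵢ[ℂ] H2 E}
    (h : ∀ v, ∀ᵐ t ∂μ, ‖(ι v : L2 E) t‖ = ‖v‖) {z : ℂ} (hz : ‖z‖ < 1) :
    ‖analyticExtension ι z‖ ≤ 1 := by
  refine ContinuousLinearMap.opNorm_le_bound _ zero_le_one fun v => ?_
  rw [analyticExtension_apply ι hz]
  refine (norm_integral_le_integral_norm _).trans (le_of_eq ?_)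
  rw [← integral_diskPoisson hz, ← integral_mul_const]
  refine integral_congr_ae ?_
  filter_upwards [h v] with t ht
  rw [norm_smul, Complex.norm_real, Real.norm_of_nonneg (diskPoisson_nonneg hz t), ht]

/-- Uniform contractivity spreads convergence from a dense sequence to all vectors, so a single null
set will serve every `v`. -/
theorem exists_isometry_tendsto {l : Filter ℝ} [l.IsCountablyGenerated] [l.NeBot]
    {T : ℝ → G →L[ℂ] E} (hT : ∀ᶠ r in l, ‖T r‖ ≤ 1) {d : ℕ → G} (hd : DenseRange d) {y : ℕ → E}
    (hy : ∀ n, Tendsto (fun r => T r (d n)) l (𝓝 (y n))) (hyd : ∀ n, ‖y n‖ = ‖d n‖) :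
    ∃ A : G →L[ℂ] E, (∀ v, Tendsto (fun r => T r v) l (𝓝 (A v))) ∧ Isometry A := by
  have hlim : ∀ v, ∃ a, Tendsto (fun r => T r v) l (𝓝 a) := by
    intro v
    rw [← cauchy_map_iff_exists_tendsto, Metric.cauchy_iff]
    refine ⟨inferInstance, fun ε hε => ?_⟩
    obtain ⟨n, hn⟩ := hd.exists_dist_lt v (show 0 < ε / 4 by positivity)
    have hev : ∀ᶠ r in l, dist (T r v) (y n) < ε / 2 := by
      filter_upwards [hT, Metric.tendsto_nhds.1 (hy n) (ε / 4) (by positivity)] with r h1 h2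
      have h3 : dist (T r v) (T r (d n)) < ε / 4 := by
        rw [dist_eq_norm, ← map_sub]
        refine lt_of_le_of_lt ((T r).le_of_opNorm_le h1 _) ?_
        rwa [one_mul, ← dist_eq_norm]
      linarith [dist_triangle (T r v) (T r (d n)) (y n)]
    refine ⟨Metric.ball (y n) (ε / 2), hev, fun a ha b hb => ?_⟩
    have := dist_triangle_right a b (y n)
    rw [Metric.mem_ball] at ha hb
    linarith
  choose a ha using hlim
  let A : G →L[ℂ] E := continuousLinearMapOfTendsto T (f := a) (tendsto_pi_nhds.2 ha)
  have hA : ∀ v, Tendsto (fun r => T r v) l (𝓝 (A v)) := ha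
  refine ⟨A, hA, (AddMonoidHomClass.isometry_iff_norm A).2 fun v => ?_⟩
  refine hd.induction_on (p := fun v => ‖A v‖ = ‖v‖) v
    (isClosed_eq (by fun_prop) (by fun_prop)) fun n => ?_
  rw [tendsto_nhds_unique (hA (d n)) (hy n), hyd]

theorem exists_isInner [TopologicalSpace.SeparableSpace G] (ι : G →ₗᵢ[ℂ] H2 E)
    (h : ∀ v (n : ℕ), inner ℂ ((shift E ^ (n + 1)) (ι v)) (ι v) = 0) :
    ∃ (Θ : ℂ → G →L[ℂ] E) (Θb : 𝕋 → G →L[ℂ] E), IsInner Θ Θb ∧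
      ∀ v, ∀ᵐ t ∂μ, Θb t v = (ι v : L2 E) t := by
  classical
  have hnorm : ∀ v, ∀ᵐ t ∂μ, ‖(ι v : L2 E) t‖ = ‖v‖ := fun v => by
    have := ae_norm_eq_of_inner_shift_pow (h v)
    rwa [ι.norm_map] at this
  have hIoo : ∀ᶠ r : ℝ in 𝓝[<] 1, r ∈ Set.Ioo (0 : ℝ) 1 := Ioo_mem_nhdsLT one_pos
  let P : 𝕋 → (G →L[ℂ] E) → Prop := fun t A =>
    (∀ v, Tendsto (fun r : ℝ => analyticExtension ι (r * fourier 1 t) v) (𝓝[<] 1) (𝓝 (A v))) ∧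
      Isometry A
  have hex : ∀ᵐ t ∂μ, ∃ A, P t A := by
    have h1 : ∀ᵐ t ∂μ, ∀ n, ‖(ι (TopologicalSpace.denseSeq G n) : L2 E) t‖ =
        ‖TopologicalSpace.denseSeq G n‖ := ae_all_iff.2 fun n => hnorm _
    have h2 : ∀ᵐ t ∂μ, ∀ n, Tendsto (fun r : ℝ => analyticExtension ι (r * fourier 1 t)
        (TopologicalSpace.denseSeq G n)) (𝓝[<] 1)
        (𝓝 ((ι (TopologicalSpace.denseSeq G n) : L2 E) t)) :=
      ae_all_iff.2 fun n => ae_tendsto_analyticExtension ι _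
    filter_upwards [h1, h2] with t ht1 ht2
    refine exists_isometry_tendsto ?_ (TopologicalSpace.denseRange_denseSeq G) ht2 ht1
    filter_upwards [hIoo] with r hr
    exact norm_analyticExtension_le hnorm (mem_ball_zero_iff.1 (mem_ball_of_mem_Ioo hr t))
  -- The value `0` is taken only on a null set.
  let Θb : 𝕋 → G →L[ℂ] E := fun t => if ht : ∃ A, P t A then ht.choose else 0
  have hΘb : ∀ᵐ t ∂μ, P t (Θb t) := by
    filter_upwards [hex] with t ht
    simp only [Θb, dif_pos ht]
    exact ht.choose_spec
  refine ⟨analyticExtension ι, Θb, ⟨⟨?_, 1, fun z hz => ?_⟩, ?_, ?_⟩, fun v => ?_⟩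
  · exact differentiableOn_tsum_pow_smul (norm_taylorCoeff_le ι)
  · exact norm_analyticExtension_le hnorm (mem_ball_zero_iff.1 hz)
  · exact hΘb.mono fun t ht => ht.1
  · exact hΘb.mono fun t ht => ht.2
  · filter_upwards [hΘb, ae_tendsto_analyticExtension ι v] with t h1 h2
    exact tendsto_nhds_unique (h1.1 v) h2

end RadialExtension

/-! ### The wandering model and the pointwise intertwining relations. -/

section Assembly

variable {E : Type*} [NormedAddCommGroup E] [InnerProductSpace ℂ E] [CompleteSpace E]

theorem fourierCoeff_orthogonalProjectionOnto (f : L2 E) (n : ℕ) :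
    fourierCoeff ((H2 E).orthogonalProjectionOnto f : L2 E) n = fourierCoeff f n := by
  refine ext_inner_left ℂ fun v => ?_
  rw [← inner_hardyMonomial_left, ← inner_monomial_left, ← coe_hardyMonomial,
    ← Submodule.inner_orthogonalProjectionOnto_eq_of_mem_left]

/-- This removes the projection: the coefficient of `Φ f` at `m` is that of `Φ z^|m| f` at `m + |m|
≥ 0`, which the projection onto `H²` leaves unchanged. -/
theorem laurent_eq_of_toeplitz_shift_pow {Φ : 𝕋 → E →L[ℂ] E} (hΦ : MemLinfty Φ) {f g : H2 E}
    (h : ∀ n : ℕ, toeplitz hΦ ((shift E ^ n) f) = (shift E ^ n) g) :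
    laurent hΦ (f : L2 E) = g := by
  rw [← sub_eq_zero]
  refine eq_zero_of_forall_fourierCoeff fun m => ?_
  have hm : ((m + m.natAbs).toNat : ℤ) = m + m.natAbs := by omega
  have h1 : fourierCoeff (laurent hΦ ((shift E ^ m.natAbs) f : L2 E)) (m + m.natAbs) =
      fourierCoeff (laurent hΦ (f : L2 E)) m := by
    have : laurent hΦ ((shift E ^ m.natAbs) f : L2 E) =ᵐ[μ]
        fun t => (fourier (m.natAbs : ℤ) t : ℂ) • laurent hΦ (f : L2 E) t := by
      filter_upwards [coeFn_laurent hΦ ((shift E ^ m.natAbs) f : L2 E),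
        coeFn_laurent hΦ (f : L2 E), coeFn_shift_pow m.natAbs f] with t h1 h2 h3
      rw [h1, h2, h3, map_smul]
    rw [fourierCoeff_congr_ae this, fourierCoeff_fourier_smul_apply, add_sub_cancel_right]
  have h2 : fourierCoeff (laurent hΦ ((shift E ^ m.natAbs) f : L2 E)) (m + m.natAbs) =
      fourierCoeff (g : L2 E) m := by
    have h3 := fourierCoeff_orthogonalProjectionOnto
      (laurent hΦ ((shift E ^ m.natAbs) f : L2 E)) (m + m.natAbs).toNat
    rw [hm] at h3
    rw [← h3]
    change fourierCoeff (toeplitz hΦ ((shift E ^ m.natAbs) f) : L2 E) _ = _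
    rw [h, fourierCoeff_shift_pow, add_sub_cancel_right]
  have h4 := (coeffL E m).map_sub (laurent hΦ (f : L2 E)) g
  exact h4.trans (sub_eq_zero.2 (h1.symm.trans h2))

/-- The closed span of the two-sided orbit of `v₀`; negative powers are included to make it
invariant under `U⁻¹` as well. -/
theorem exists_separable_invariant {F : Type*} [NormedAddCommGroup F] [InnerProductSpace ℂ F]
    (U : F ≃ₗᵢ[ℂ] F) {v₀ : F} (hv₀ : v₀ ≠ 0) :
    ∃ G : Submodule ℂ F, IsClosed (G : Set F) ∧ TopologicalSpace.IsSeparable (G : Set F) ∧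
      (∃ v ∈ G, v ≠ 0) ∧ (∀ v ∈ G, U v ∈ G) ∧ ∀ v ∈ G, U.symm v ∈ G := by
  set D : Set F := Set.range fun n : ℤ => (U ^ n) v₀ with hD
  have hinv : ∀ A : F ≃ₗᵢ[ℂ] F, (∀ v ∈ D, A v ∈ D) →
      ∀ v ∈ (Submodule.span ℂ D).topologicalClosure,
        A v ∈ (Submodule.span ℂ D).topologicalClosure := by
    intro A hA v hv
    refine map_mem_closure A.continuous hv fun w hw => ?_
    have h1 : Submodule.span ℂ D ≤
        (Submodule.span ℂ D).comap (A.toLinearEquiv : F →ₗ[ℂ] F) :=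
      Submodule.span_le.2 fun w hw => Submodule.subset_span (hA w hw)
    exact h1 hw
  refine ⟨(Submodule.span ℂ D).topologicalClosure, Submodule.isClosed_topologicalClosure _, ?_,
    ⟨v₀, ?_, hv₀⟩, hinv U ?_, hinv U.symm ?_⟩
  · exact ((Set.countable_range _).isSeparable.span (R := ℂ)).closure
  · exact Submodule.le_topologicalClosure _ (Submodule.subset_span ⟨0, by simp⟩)
  · rintro _ ⟨n, rfl⟩
    exact ⟨1 + n, by beta_reduce; rw [zpow_one_add]; rfl⟩
  · rintro _ ⟨n, rfl⟩
    exact ⟨-1 + n, by beta_reduce; rw [zpow_add, zpow_neg_one]; rfl⟩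

theorem exists_isometry_unitary {H : Type*} [NormedAddCommGroup H] [InnerProductSpace ℂ H]
    [CompleteSpace H] {A T : H →L[ℂ] H} (hA : ∀ f, ‖A f‖ = ‖f‖)
    (hA0 : ∀ f, (∀ n : ℕ, ∃ g, (A ^ n) g = f) → f = 0)
    (hT : ∀ f g, inner ℂ (T (A f)) (A g) = inner ℂ (T f) g) {S : Submodule ℂ H}
    (hSA : ∀ f ∈ S, A f ∈ S) (hS : Reduces S T) (hSU : IsUnitaryOn S T) :
    ∃ (M : S →ₗᵢ[ℂ] S) (V : S ≃ₗᵢ[ℂ] S),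
      (∀ (n : ℕ) f, ((M ^ n) f : H) = (A ^ n) f) ∧ (∀ f, (V f : H) = T f) ∧
      (∀ f, (V.symm f : H) = T.adjoint f) ∧ (∀ f, V (M f) = M (V f)) ∧
      ∀ f, (∀ n : ℕ, ∃ g, (M ^ n) g = f) → f = 0 := by
  obtain ⟨V, hV⟩ := hSU
  let M : S →ₗᵢ[ℂ] S :=
    { toLinearMap := (A : H →ₗ[ℂ] H).restrict hSA
      norm_map' := fun f => hA (f : H) }
  have hM : ∀ f, (M f : H) = A f := fun f => rfl
  have hMn : ∀ (n : ℕ) f, ((M ^ n) f : H) = (A ^ n) f := by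
    intro n
    induction n with
    | zero => exact fun f => rfl
    | succ n ih =>
      intro f
      rw [pow_succ, pow_succ]
      exact ih (M f)
  have hc : ∀ f, V (M f) = M (V f) := by
    refine commute_of_inner_eq M V fun f g => ?_
    rw [Submodule.coe_inner, Submodule.coe_inner, hV, hV, hM, hM, hT]
  refine ⟨M, V, hMn, hV, fun f => ?_, hc, fun f hf => ?_⟩
  -- Since `T* f` stays in `S`, it is the adjoint of `V` applied to `f`, and the adjoint of a
  -- unitary is its inverse.
  · have h1 : V.symm f = ⟨T.adjoint f, hS.adjoint_map_mem f f.2⟩ := by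
      refine ext_inner_right ℂ fun g => ?_
      have h2 : inner ℂ (V.symm f) g = inner ℂ f (V g) := by
        rw [← V.inner_map_map, V.apply_symm_apply]
      rw [h2]
      change inner ℂ (f : H) (V g : H) = inner ℂ (T.adjoint f) (g : H)
      rw [hV, ContinuousLinearMap.adjoint_inner_left]
    rw [h1]
  · refine Subtype.ext (hA0 _ fun n => ?_)
    obtain ⟨g, rfl⟩ := hf n
    exact ⟨g, (hMn n g).symm⟩

/-- Otherwise every summand of the Wold decomposition is zero, and the identity equals the zero
operator. -/
theorem exists_mem_wandering_ne_zero {H : Type*} [NormedAddCommGroup H] [InnerProductSpace ℂ H]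
    [CompleteSpace H] {M : H →ₗᵢ[ℂ] H} (hM : ∀ f, (∀ n : ℕ, ∃ g, (M ^ n) g = f) → f = 0)
    {f : H} (hf : f ≠ 0) : ∃ v : wandering M, v ≠ 0 := by
  by_contra! h0
  have h1 : ContinuousLinearMap.id ℂ H = 0 :=
    IsHilbertSum.eq_of_forall_apply (isHilbertSum_wandering M hM) fun n v => by
      rw [h0 v, map_zero, map_zero, map_zero]
  exact hf (congrArg (fun A : H →L[ℂ] H => A f) h1)

/-- The Wold decomposition of the restriction of `A` to `S`, together with the unitary part of `T`
on the wandering subspace. -/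
theorem exists_wandering_model {H : Type u} [NormedAddCommGroup H] [InnerProductSpace ℂ H]
    [CompleteSpace H] {A T : H →L[ℂ] H} (hA : ∀ f, ‖A f‖ = ‖f‖)
    (hA0 : ∀ f, (∀ n : ℕ, ∃ g, (A ^ n) g = f) → f = 0)
    (hT : ∀ f g, inner ℂ (T (A f)) (A g) = inner ℂ (T f) g) {S : Submodule ℂ H}
    (hSc : IsClosed (S : Set H)) (hS0 : S ≠ ⊥) (hSA : ∀ f ∈ S, A f ∈ S) (hS : Reduces S T)
    (hSU : IsUnitaryOn S T) :
    ∃ (F : Type u) (_ : NormedAddCommGroup F) (_ : InnerProductSpace ℂ F) (_ : CompleteSpace F)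
      (U : F ≃ₗᵢ[ℂ] F) (J : F →ₗᵢ[ℂ] H), Nontrivial F ∧
      (∀ (n : ℕ) v, T ((A ^ n) (J v)) = (A ^ n) (J (U v))) ∧
      (∀ (n : ℕ) v, T.adjoint ((A ^ n) (J v)) = (A ^ n) (J (U.symm v))) ∧
      (∀ (n : ℕ) v w, inner ℂ ((A ^ (n + 1)) (J v)) (J w) = 0) ∧
      ∀ {K : Type u} [NormedAddCommGroup K] [InnerProductSpace ℂ K] [CompleteSpace K]
        {B : ℕ → F →ₗᵢ[ℂ] K} (_ : IsHilbertSum ℂ (fun _ : ℕ => F) B) {R : K →L[ℂ] K}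
        (_ : ∀ n v, R (B n v) = B n (U v)),
        ∃ W : S ≃ₗᵢ[ℂ] K, ∀ f : S, W ((T : H →ₗ[ℂ] H).restrict hS.map_mem f) = R (W f) := by
  have : CompleteSpace S := hSc.completeSpace_coe
  obtain ⟨M, V, hM, hV, hV', hVM, hM0⟩ := exists_isometry_unitary hA hA0 hT hSA hS hSU
  have hVM' := map_symm_commute hVM
  obtain ⟨f, hfS, hf⟩ := (Submodule.ne_bot_iff S).1 hS0
  obtain ⟨v₀, hv₀⟩ := exists_mem_wandering_ne_zero hM0 (f := ⟨f, hfS⟩)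
    fun h => hf (congrArg Subtype.val h)
  let U := restrictUnitary V (wandering M) (fun v hv => map_mem_wandering hVM hv)
    (fun v hv => map_mem_wandering (V := V.symm) hVM' hv)
  have hH := isHilbertSum_wandering M hM0
  refine ⟨wandering M, inferInstance, inferInstance, inferInstance, U,
    S.subtypeₗᵢ.comp (wandering M).subtypeₗᵢ, ⟨v₀, 0, hv₀⟩, fun n v => ?_, fun n v => ?_,
    fun n v w => ?_, ?_⟩
  · change T ((A ^ n) ((v : S) : H)) = (A ^ n) ((V (v : S) : S) : H)
    rw [← hM, ← hM, ← hV, pow_commute hVM]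
  · change T.adjoint ((A ^ n) ((v : S) : H)) = (A ^ n) ((V.symm (v : S) : S) : H)
    rw [← hM, ← hM, ← hV', pow_commute (V := V.symm) hVM']
  · change inner ℂ ((A ^ (n + 1)) ((v : S) : H)) ((w : S) : H) = 0
    rw [← hM, ← Submodule.coe_inner, pow_succ']
    exact mem_wandering.1 w.2 _
  · intro K _ _ _ B hB R hR
    obtain ⟨W, hW⟩ := IsHilbertSum.exists_unitary hH hB
    refine ⟨W, ?_⟩
    -- Both operators act on the `n`-th summand by `U` on coefficients, so comparing them there
    -- suffices.
    have key : (W : S →L[ℂ] K) ∘L (V : S →L[ℂ] S) = R ∘L (W : S →L[ℂ] K) := by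
      refine IsHilbertSum.eq_of_forall_apply hH fun n v => ?_
      change W (V ((M ^ n) (v : S))) = R (W ((M ^ n).comp (wandering M).subtypeₗᵢ v))
      rw [pow_commute hVM, hW, hR, ← hW]
      rfl
    intro f
    have h1 : (T : H →ₗ[ℂ] H).restrict hS.map_mem f = V f := Subtype.ext (hV f).symm
    rw [h1]
    exact congrArg (fun Q : S →L[ℂ] K => Q f) key

theorem exists_isInner_of_model {Φ : 𝕋 → E →L[ℂ] E} (hΦ : MemLinfty Φ)
    {F : Type u} [NormedAddCommGroup F] [InnerProductSpace ℂ F] [CompleteSpace F] [Nontrivial F]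
    (U : F ≃ₗᵢ[ℂ] F) (J : F →ₗᵢ[ℂ] H2 E)
    (h1 : ∀ (n : ℕ) v, toeplitz hΦ ((shift E ^ n) (J v)) = (shift E ^ n) (J (U v)))
    (h2 : ∀ (n : ℕ) v, (toeplitz hΦ).adjoint ((shift E ^ n) (J v)) =
      (shift E ^ n) (J (U.symm v)))
    (h3 : ∀ (n : ℕ) v w, inner ℂ ((shift E ^ (n + 1)) (J v)) (J w) = 0) :
    ∃ (G : Type u) (_ : NormedAddCommGroup G) (_ : InnerProductSpace ℂ G) (_ : CompleteSpace G)
      (_ : Nontrivial G) (Θ : ℂ → G →L[ℂ] E) (Θb : 𝕋 → G →L[ℂ] E) (U : G ≃ₗᵢ[ℂ] G),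
      IsInner Θ Θb ∧
      (∀ᵐ t ∂μ, Φ t ∘L Θb t = Θb t ∘L (U : G →L[ℂ] G)) ∧
      (∀ᵐ t ∂μ, (Φ t).adjoint ∘L Θb t = Θb t ∘L (U : G →L[ℂ] G).adjoint) := by
  obtain ⟨v₀, hv₀⟩ := exists_ne (0 : F)
  obtain ⟨G, hGc, hGs, ⟨v₁, hv₁, hv₁0⟩, hGU, hGU'⟩ := exists_separable_invariant U hv₀
  have : CompleteSpace G := hGc.completeSpace_coe
  have : TopologicalSpace.SeparableSpace G := hGs.separableSpace
  let ι : G →ₗᵢ[ℂ] H2 E := J.comp G.subtypeₗᵢ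
  obtain ⟨Θ, Θb, hΘ, hΘι⟩ := exists_isInner ι fun v n => h3 n v v
  let UG := restrictUnitary U G hGU hGU'
  -- Stated for a general symbol so as to serve both `Φ` with `U` and `Φ*` with `U⁻¹`. A countable
  -- dense set of vectors again yields one null set.
  have key : ∀ {Ψ : 𝕋 → E →L[ℂ] E} (hΨ : MemLinfty Ψ) (A : G →L[ℂ] G),
      (∀ (n : ℕ) v, toeplitz hΨ ((shift E ^ n) (ι v)) = (shift E ^ n) (ι (A v))) →
      ∀ᵐ t ∂μ, Ψ t ∘L Θb t = Θb t ∘L A := by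
    intro Ψ hΨ A hA
    let d := TopologicalSpace.denseSeq G
    have h4 : ∀ᵐ t ∂μ, ∀ n, Ψ t (Θb t (d n)) = Θb t (A (d n)) := by
      refine ae_all_iff.2 fun n => ?_
      have h5 := laurent_eq_of_toeplitz_shift_pow hΨ (f := ι (d n)) fun k => hA k (d n)
      have h6 := coeFn_laurent hΨ (ι (d n) : L2 E)
      rw [h5] at h6
      filter_upwards [h6, hΘι (d n), hΘι (A (d n))] with t h7 h8 h9
      rw [h8, h9, h7]
    filter_upwards [h4] with t ht
    ext v
    refine (TopologicalSpace.denseRange_denseSeq G).induction_on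
      (p := fun v => Ψ t (Θb t v) = Θb t (A v)) v ?_ ht
    exact isClosed_eq (by fun_prop) (by fun_prop)
  refine ⟨G, inferInstance, inferInstance, inferInstance,
    ⟨⟨v₁, hv₁⟩, 0, fun h => hv₁0 (congrArg Subtype.val h)⟩, Θ, Θb, UG, hΘ,
    key hΦ (UG : G →L[ℂ] G) fun n v => h1 n v, ?_⟩
  rw [LinearIsometryEquiv.adjoint_eq_symm]
  refine key hΦ.adjoint _ fun n v => ?_
  rw [← adjoint_toeplitz]
  exact h2 n v

end Assembly

end HardyToeplitz

theorem proposition3p6 {E : Type u} [NormedAddCommGroup E] [InnerProductSpace ℂ E]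
    [CompleteSpace E] (Φ : 𝕋 → E →L[ℂ] E) (hΦ : MemLinfty Φ) :
    ((∃ (F : Type u) (_ : NormedAddCommGroup F) (_ : InnerProductSpace ℂ F) (_ : CompleteSpace F)
        (_ : Nontrivial F) (Θ : ℂ → F →L[ℂ] E) (Θb : 𝕋 → F →L[ℂ] E) (U : F ≃ₗᵢ[ℂ] F),
        IsInner Θ Θb ∧
        (∀ᵐ t ∂μ, Φ t ∘L Θb t = Θb t ∘L (U : F →L[ℂ] F)) ∧
        (∀ᵐ t ∂μ, (Φ t).adjoint ∘L Θb t = Θb t ∘L (U : F →L[ℂ] F).adjoint)) ↔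
      ∃ S : Submodule ℂ (H2 E), IsShiftInvariantUnitaryPart (toeplitz hΦ) S) ∧
    (∀ (S : Submodule ℂ (H2 E)) (hS : IsShiftInvariantUnitaryPart (toeplitz hΦ) S),
      ∃ (F : Type u) (_ : NormedAddCommGroup F) (_ : InnerProductSpace ℂ F) (_ : CompleteSpace F)
        (U : F ≃ₗᵢ[ℂ] F) (W : S ≃ₗᵢ[ℂ] H2 F),
        ∀ f : S,
          W ((toeplitz hΦ : H2 E →ₗ[ℂ] H2 E).restrict hS.reduces.map_mem f) =
            toeplitz (memLinfty_const (U : F →L[ℂ] F)) (W f)) := by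
  have hmodel := fun (S : Submodule ℂ (H2 E))
      (hS : IsShiftInvariantUnitaryPart (toeplitz hΦ) S) =>
    exists_wandering_model (A := shift E) (T := toeplitz hΦ) norm_shift (fun _ => eq_zero_of_forall_mem_range_shift_pow)
      (inner_toeplitz_shift_shift hΦ) hS.closed hS.ne_bot hS.shift_mem hS.reduces hS.unitary
  refine ⟨⟨?_, ?_⟩, fun S hS => ?_⟩
  · rintro ⟨F, _, _, _, _, Θ, Θb, U, hΘ, h1, h2⟩
    exact ⟨_, hΘ.isShiftInvariantUnitaryPart hΦ h1 h2⟩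
  · rintro ⟨S, hS⟩
    obtain ⟨F, _, _, _, U, J, _, h1, h2, h3, -⟩ := hmodel S hS
    exact exists_isInner_of_model hΦ U J h1 h2 h3
  · obtain ⟨F, i1, i2, i3, U, J, -, -, -, -, hW⟩ := hmodel S hS
    obtain ⟨W, hW⟩ := hW isHilbertSum_hardyMonomial
      (toeplitz_const_hardyMonomial (U : F →L[ℂ] F))
    exact ⟨F, i1, i2, i3, U, W, hW⟩
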